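/- Let $n\ge 1$, let $k_1,\dots,k_n\ge 1$ be integers, $\mathcal M=\{1^{k_1},2^{k_2},\dots,n^{k_n}\}$ the multiset in which $i$ occurs $k_i$ times, and $K=k_1+\cdots+k_n$. A permutation $\pi=\pi_1\cdots\pi_K$ of $\mathcal M$ is quasi-Stirling if there are no indices $i<j<k<\ell$ with $\pi_i=\pi_k$, $\pi_j=\pi_\ell$ and $\pi_i\ne\pi_j$. Let $\overline{\mathcal Q}_{\mathcal M}$ be the set of quasi-Stirling permutations of $\mathcal M$. With the convention $\pi_0=\pi_{K+1}=0$, let $asc(\pi)$, $des(\pi)$, $plat(\pi)$ be the number of indices $0\le i\le K$ with $\pi_i<\pi_{i+1}$, $\pi_i>\pi_{i+1}$, $\pi_i=\pi_{i+1}$, respectively, and let $$\overline Q_{\mathcal M}(x,y,z)=\sum_{\pi\in\overline{\mathcal Q}_{\mathcal M}}x^{asc(\pi)}y^{des(\pi)}z^{plat(\pi)}.$$ A polynomial $h(x,y)$ is homogeneous $\gamma$-positive if $h=\sum_{k=0}^{\lfloor m/2\rfloor}\gamma_k(xy)^k(x+y)^{m-2k}$ for some $m$ and some $\gamma_k\ge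 0$; a polynomial $p(x,y,z)=\sum_i s_i(x,y)z^i$ is partial $\gamma$-positive if every $s_i$ is homogeneous $\gamma$-positive. Let $\mathcal T_{\mathcal M}$ be the set of ordered rooted trees whose vertices are labeled by the elements of the multiset $\{0\}\cup\mathcal M$, such that the root has label $0$ and every vertex at odd level with label $i$ has exactly $k_i-1$ children, all of them with label $i$ (the level of a vertex is its distance from the root). For a vertex $u$ with label $v_0$ and children labeled $v_1,\dots,v_\ell$ from left to right, the word of $u$ is $v_0v_1\cdots v_\ell$, read cyclically. Let $cdes(T)$ be the sum, over all vertices $u$ of $T$, of the number of entries of the word of $u$ that are larger than their cyclic successor. Let $eleaf(T)$ be the number of leaves at even level. An entry of a word is a double cyclic descent if it is smaller than its cyclic predecessor and larger than its cyclic successor. A vertex at even level is a double cyclic descent of $T$ if the entry $v_0$ is one in its own word, and a vertex at odd level is one if its entry is one in the word of its parent. Let $dcdes(T)$ be the number of double cyclic descents of $T$. Theorem. The polynomial $\overline Q_{\mathcal M}(x,y,z)$ is partial $\gamma$-positive and has the expansion $$\overline Q_{\mathcal M}(x,y,z)=\sum_{i=0}^{K-n}z^i\sum_{j=1}^{\lfloor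 (K+1-i)/2\rfloor}\gamma_{\mathcal M,i,j}\,(xy)^j(x+y)^{K+1-i-2j},$$ where $\gamma_{\mathcal M,i,j}=|\{T\in\mathcal T_{\mathcal M}: cdes(T)=j,\ eleaf(T)=i,\ dcdes(T)=0\}|$. (In particular $\mathcal T_{\mathcal M}$ is finite.) -/

import Mathlib

namespace QuasiStirling

/-! ### Multiset permutations and their statistics -/

/-- The multiset `{1^{k_1}, 2^{k_2}, …, n^{k_n}}`, where `k_{i+1}` is `k i` for `i : Fin n`. -/
def multisetOf {n : ℕ} (k : Fin n → ℕ) : Multiset ℕ :=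
  ∑ i : Fin n, Multiset.replicate (k i) (i.val + 1)

/-- A word is quasi-Stirling if it avoids the pattern `1212` (and `2121`): there are no positions
`i < j < k < l` whose letters are `a, b, a, b` with `a ≠ b`. -/
def IsQuasiStirling (π : List ℕ) : Prop :=
  ¬ ∃ i j k l : Fin π.length, i < j ∧ j < k ∧ k < l ∧
    π.get i = π.get k ∧ π.get j = π.get l ∧ π.get i ≠ π.get j

instance : DecidablePred IsQuasiStirling := fun π =>
  inferInstanceAs (Decidable (¬ ∃ i j k l : Fin π.length, i < j ∧ j < k ∧ k < l ∧
    π.get i = π.get k ∧ π.get j = π.get l ∧ π.get i ≠ π.get j))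

/-- The finite set of quasi-Stirling permutations of the multiset `M`; `M.lists` enumerates
exactly the words whose multiset of letters is `M`, possibly with repetition. -/
def quasiStirlingPerms (M : Multiset ℕ) : Finset (List ℕ) :=
  M.lists.toFinset.filter IsQuasiStirling

/-- The entry `π_i` of `π = π_1 ⋯ π_m` for `0 ≤ i ≤ m + 1`, with the convention
`π_0 = π_{m+1} = 0`. -/
def entry (π : List ℕ) (i : ℕ) : ℕ := (0 :: π).getD i 0

/-- The number of ascents, over the indices `0 ≤ i ≤ m`. -/
def asc (π : List ℕ) : ℕ :=
  ((Finset.range (π.length + 1)).filter fun i => entry π i < entry π (i + 1)).card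

/-- The number of descents, over the indices `0 ≤ i ≤ m`. -/
def des (π : List ℕ) : ℕ :=
  ((Finset.range (π.length + 1)).filter fun i => entry π i > entry π (i + 1)).card

/-- The number of plateaux, over the indices `0 ≤ i ≤ m`. -/
def plat (π : List ℕ) : ℕ :=
  ((Finset.range (π.length + 1)).filter fun i => entry π i = entry π (i + 1)).card

/-- The polynomial `∑ x^{asc π} y^{des π} z^{plat π}` over the quasi-Stirling permutations `π`
of `M`; the variables `x, y, z` are `X 0, X 1, X 2`. -/
noncomputable def quasiStirlingPoly (M : Multiset ℕ) : MvPolynomial (Fin 3) ℤ :=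
  ∑ π ∈ quasiStirlingPerms M,
    MvPolynomial.X 0 ^ asc π * MvPolynomial.X 1 ^ des π * MvPolynomial.X 2 ^ plat π

/-! ### Gamma-positivity -/

/-- A bivariate polynomial `h(x, y)` is homogeneous γ-positive if, for some `m`,
`h = ∑_{k=0}^{⌊m/2⌋} γ_k (xy)^k (x+y)^{m-2k}` with all `γ_k ≥ 0`. -/
def HomogeneousGammaPositive (h : MvPolynomial (Fin 2) ℤ) : Prop :=
  ∃ (m : ℕ) (γ : ℕ → ℤ), (∀ k, 0 ≤ γ k) ∧
    h = ∑ k ∈ Finset.range (m / 2 + 1),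
      MvPolynomial.C (γ k) * (MvPolynomial.X 0 * MvPolynomial.X 1) ^ k *
        (MvPolynomial.X 0 + MvPolynomial.X 1) ^ (m - 2 * k)

/-- A trivariate polynomial `p(x, y, z) = ∑_i s_i(x, y) z^i` is partial γ-positive if every `s_i`
is homogeneous γ-positive. -/
def PartialGammaPositive (p : MvPolynomial (Fin 3) ℤ) : Prop :=
  ∃ (N : ℕ) (s : ℕ → MvPolynomial (Fin 2) ℤ),
    p = ∑ i ∈ Finset.range N,
      MvPolynomial.rename Fin.castSucc (s i) * MvPolynomial.X 2 ^ i ∧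
    ∀ i, HomogeneousGammaPositive (s i)

/-! ### Cyclic statistics of words -/

/-- The `i`-th entry of `w` (positions counted from `0`), read cyclically. -/
def cyclicEntry (w : List ℕ) (i : ℕ) : ℕ := w.getD (i % w.length) 0

/-- The number of cyclic descents of a word. -/
def wordCdes (w : List ℕ) : ℕ :=
  ((Finset.range w.length).filter fun i => cyclicEntry w i > cyclicEntry w (i + 1)).card

/-- The entry at position `i < w.length` of `w` is a double cyclic descent: it is smaller than its
cyclic predecessor and larger than its cyclic successor. -/
def IsDoubleCyclicDescent (w : List ℕ) (i : ℕ) : Prop :=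
  cyclicEntry w (i + w.length - 1) > cyclicEntry w i ∧ cyclicEntry w i > cyclicEntry w (i + 1)

instance (w : List ℕ) : DecidablePred (IsDoubleCyclicDescent w) := fun i =>
  inferInstanceAs (Decidable (cyclicEntry w (i + w.length - 1) > cyclicEntry w i ∧
    cyclicEntry w i > cyclicEntry w (i + 1)))

/-! ### Ordered labeled trees -/

/-- Ordered (plane) rooted trees with vertices labeled by natural numbers: the label of the root,
and the list of the subtrees at its children from left to right. -/
inductive OTree : Type
  | node (label : ℕ) (children : List OTree) : OTree

namespace OTree

/-- The label of the root. -/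
def label : OTree → ℕ
  | node a _ => a

/-- The subtrees at the children of the root, from left to right. -/
def children : OTree → List OTree
  | node _ ts => ts

/-- The list of all vertices of a tree whose root is put at level `d`. Each vertex is listed once,
as the pair of its level and the subtree rooted at it. -/
def verticesFrom (d : ℕ) : OTree → List (ℕ × OTree)
  | node a ts => (d, node a ts) :: ts.attach.flatMap fun t => verticesFrom (d + 1) t.1
termination_by t => sizeOf t
decreasing_by
  have h := List.sizeOf_lt_of_mem t.2
  simp only [node.sizeOf_spec]
  omega

/-- All vertices of a tree, each with its level (the root has level `0`) and the subtree rooted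
at it. -/
def vertices (T : OTree) : List (ℕ × OTree) := verticesFrom 0 T

/-- The word `v_0 v_1 ⋯ v_ℓ` of a vertex: its own label `v_0`, followed by the labels of its
children from left to right. -/
def word (u : OTree) : List ℕ := u.label :: u.children.map label

/-- The number of cyclic descents of a tree: the sum over all vertices `u` of the number of
cyclic descents of the word of `u`. -/
def cdes (T : OTree) : ℕ := (T.vertices.map fun v => wordCdes v.2.word).sum

/-- The number of leaves at even level. -/
def eleaf (T : OTree) : ℕ :=
  T.vertices.countP fun v => decide (Even v.1) && v.2.children.isEmpty

/-- The number of vertices of a tree that are double cyclic descents. Let `v_0 v_1 ⋯ v_ℓ` be the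
word of an even vertex `u`. The vertex `u` itself is a double cyclic descent if `v_0` is one in this
word, and the `i`-th child of `u`, an odd vertex, is one if `v_i` is. Every odd vertex is a child of
exactly one even vertex, so all vertices are counted once by going through the even ones. -/
def dcdes (T : OTree) : ℕ :=
  ((T.vertices.filter fun v => decide (Even v.1)).map fun v =>
    (if IsDoubleCyclicDescent v.2.word 0 then 1 else 0) +
      ((Finset.Icc 1 v.2.children.length).filter (IsDoubleCyclicDescent v.2.word)).card).sum

end OTree

/-- The set `𝒯_M` of ordered labeled trees whose vertices are labeled by the elements of
`{0} ∪ M`, whose root is labeled by `0`, and in which every odd vertex labeled by `i` has exactly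
`k_i - 1` children, all labeled by `i`, where `k_i` is the multiplicity of `i` in `M`. -/
def trees (M : Multiset ℕ) : Set OTree :=
  {T | (T.vertices.map fun v => v.2.label : Multiset ℕ) = 0 ::ₘ M ∧
    T.label = 0 ∧
    ∀ v ∈ T.vertices, Odd v.1 →
      v.2.children.length = M.count v.2.label - 1 ∧
      ∀ c ∈ v.2.children, c.label = v.2.label}

/-- The number of trees `T` in `𝒯_M` with `cdes T = j`, `eleaf T = i` and `dcdes T = 0`. -/
noncomputable def gammaCoeff (M : Multiset ℕ) (i j : ℕ) : ℕ :=
  {T ∈ trees M | T.cdes = j ∧ T.eleaf = i ∧ T.dcdes = 0}.ncard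

end QuasiStirling

namespace QuasiStirling

/-! ### Products over the entries of a word with their neighbours -/

/-- The product of `F p a q` over the entries `a` of a word, where `p` and `q` are the predecessor
and the successor of `a`; the word is flanked by the two given letters. -/
def triProd {R : Type*} [CommMonoid R] (F : ℕ → ℕ → ℕ → R) : ℕ → List ℕ → ℕ → R
  | _, [], _ => 1
  | p, a :: l, q => F p a (l.headD q) * triProd F a l q

/-- The product of `F p a q` over the entries `a` of the cyclic word `v :: l`, where `p` and `q`
are the cyclic predecessor and the cyclic successor of `a`. -/
def cycProd {R : Type*} [CommMonoid R] (F : ℕ → ℕ → ℕ → R) (v : ℕ) (l : List ℕ) : R :=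
  F (l.getLastD v) v (l.headD v) * triProd F v l v

/-- The product of `g a b` over the pairs of adjacent letters of the word `p :: l ++ [q]`. -/
def pairProd {R : Type*} [CommMonoid R] (g : ℕ → ℕ → R) : ℕ → List ℕ → ℕ → R
  | p, [], q => g p q
  | p, a :: l, q => g p a * pairProd g a l q

lemma headD_append_cons (l₁ l₂ : List ℕ) (a q : ℕ) : (l₁ ++ a :: l₂).headD q = l₁.headD a := by
  cases l₁ <;> rfl

lemma getLastD_append_cons (l₁ l₂ : List ℕ) (a q : ℕ) :
    (l₁ ++ a :: l₂).getLastD q = l₂.getLastD a := by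
  induction l₁ generalizing q with
  | nil => exact List.getLastD_cons
  | cons b l ih => rw [List.cons_append, List.getLastD_cons, ih]

lemma append_cons_inj_of_notMem {a : ℕ} {l₁ l₂ m₁ m₂ : List ℕ} (h₁ : a ∉ l₁) (h₂ : a ∉ m₁)
    (h : l₁ ++ a :: l₂ = m₁ ++ a :: m₂) : l₁ = m₁ ∧ l₂ = m₂ := by
  induction l₁ generalizing m₁ with
  | nil =>
    cases m₁ with
    | nil => simpa using h
    | cons b m => exact absurd (List.cons.inj h).1 (fun e => h₂ (by simp [e]))
  | cons c l ih =>
    cases m₁ with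
    | nil => exact absurd (List.cons.inj h).1.symm (fun e => h₁ (by simp [e]))
    | cons b m =>
      simp only [List.cons_append, List.cons.injEq, List.mem_cons, not_or] at h h₁ h₂
      obtain ⟨rfl, rfl⟩ := ih h₁.2 h₂.2 h.2
      exact ⟨by rw [h.1], rfl⟩

section
variable {R : Type*} [CommMonoid R]

lemma triProd_append_cons (F : ℕ → ℕ → ℕ → R) (p : ℕ) (l₁ : List ℕ) (a : ℕ) (l₂ : List ℕ) (q : ℕ) :
    triProd F p (l₁ ++ a :: l₂) q =
      triProd F p l₁ a * F (l₁.getLastD p) a (l₂.headD q) * triProd F a l₂ q := by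
  induction l₁ generalizing p with
  | nil => simp [triProd]
  | cons b l ih => simp only [List.cons_append, triProd, ih, headD_append_cons, List.getLastD_cons,
      mul_assoc]

lemma cycProd_rotate (F : ℕ → ℕ → ℕ → R) (v : ℕ) (l₁ : List ℕ) (a : ℕ) (l₂ : List ℕ) :
    cycProd F v (l₁ ++ a :: l₂) = cycProd F a (l₂ ++ v :: l₁) := by
  simp only [cycProd, triProd_append_cons, headD_append_cons, getLastD_append_cons]
  ac_rfl

lemma pairProd_append_cons (g : ℕ → ℕ → R) (p : ℕ) (l₁ : List ℕ) (a : ℕ) (l₂ : List ℕ) (q : ℕ) :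
    pairProd g p (l₁ ++ a :: l₂) q = pairProd g p l₁ a * pairProd g a l₂ q := by
  induction l₁ generalizing p with
  | nil => rfl
  | cons b l ih => simp only [List.cons_append, pairProd, ih, mul_assoc]

lemma pairProd_eq_triProd (g : ℕ → ℕ → R) (p : ℕ) (l : List ℕ) (q : ℕ) :
    pairProd g p l q = g p (l.headD q) * triProd (fun _ a b => g a b) p l q := by
  induction l generalizing p with
  | nil => simp [pairProd, triProd]
  | cons b l ih => simp [pairProd, triProd, ih]

lemma pairProd_eq_cycProd (g : ℕ → ℕ → R) (v : ℕ) (l : List ℕ) :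
    pairProd g v l v = cycProd (fun _ a b => g a b) v l :=
  pairProd_eq_triProd g v l v

lemma prod_range_eq_pairProd (g : ℕ → ℕ → R) (p : ℕ) (l : List ℕ) (q : ℕ) :
    ∏ i ∈ Finset.range (l.length + 1), g ((p :: l).getD i q) ((p :: l).getD (i + 1) q) =
      pairProd g p l q := by
  induction l generalizing p with
  | nil => simp [pairProd]
  | cons b l ih =>
    rw [Finset.prod_range_succ', mul_comm, pairProd, ← ih]
    simp

lemma triProd_eq_prod_range (F : ℕ → ℕ → ℕ → R) (p : ℕ) (l : List ℕ) (q : ℕ) :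
    triProd F p l q = ∏ i ∈ Finset.range l.length,
      F ((p :: l).getD i q) ((p :: l).getD (i + 1) q) ((p :: l).getD (i + 2) q) := by
  induction l generalizing p with
  | nil => simp [triProd]
  | cons b l ih =>
    rw [triProd, ih, List.length_cons, Finset.prod_range_succ', mul_comm]
    cases l <;> simp

lemma cyclicEntry_add_length (w : List ℕ) (i : ℕ) :
    cyclicEntry w (i + w.length) = cyclicEntry w i := by
  simp [cyclicEntry]

lemma cyclicEntry_eq_getD (v : ℕ) (l : List ℕ) (i : ℕ) (hi : i ≤ l.length + 1) :
    cyclicEntry (v :: l) i = (v :: l).getD i v := by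
  unfold cyclicEntry
  rcases hi.eq_or_lt with rfl | hi
  · simp
  · rw [List.length_cons, Nat.mod_eq_of_lt hi]
    have hi' : i < (v :: l).length := hi
    rw [List.getD_eq_getElem _ _ hi', List.getD_eq_getElem _ _ hi']

lemma cyclicEntry_length (v : ℕ) (l : List ℕ) : cyclicEntry (v :: l) l.length = l.getLastD v := by
  rw [cyclicEntry_eq_getD _ _ _ (by omega)]
  induction l generalizing v with
  | nil => simp
  | cons a l ih =>
    rw [List.length_cons, List.getD_cons_succ, List.getLastD_cons, ← ih]
    rw [List.getD_eq_getElem _ _ (by simp), List.getD_eq_getElem _ _ (by simp)]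

lemma cyclicEntry_one (v : ℕ) (l : List ℕ) : cyclicEntry (v :: l) 1 = l.headD v := by
  rw [cyclicEntry_eq_getD _ _ _ (by omega)]
  cases l <;> simp

/-- A product over the positions of a cyclic word, in recursive form. -/
lemma prod_range_eq_cycProd (F : ℕ → ℕ → ℕ → R) (v : ℕ) (l : List ℕ) :
    ∏ i ∈ Finset.range (v :: l).length, F (cyclicEntry (v :: l) (i + (v :: l).length - 1))
      (cyclicEntry (v :: l) i) (cyclicEntry (v :: l) (i + 1)) = cycProd F v l := by
  have h0 : cyclicEntry (v :: l) 0 = v := by simp [cyclicEntry]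
  rw [List.length_cons, Finset.prod_range_succ', mul_comm, cycProd, triProd_eq_prod_range]
  congr 1
  · rw [show 0 + (l.length + 1) - 1 = l.length by omega, cyclicEntry_length, h0, zero_add,
      cyclicEntry_one]
  · refine Finset.prod_congr rfl fun i hi => ?_
    have hi := Finset.mem_range.1 hi
    rw [show i + 1 + (l.length + 1) - 1 = i + (v :: l).length by simp; omega,
      cyclicEntry_add_length, cyclicEntry_eq_getD _ _ _ (by omega),
      cyclicEntry_eq_getD _ _ _ (by omega), cyclicEntry_eq_getD _ _ _ (by omega)]

/-- Invariance of a product over the positions of a cyclic word under a rotation. -/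
@[to_additive]
lemma prod_range_succ_eq {m : ℕ} (h : ℕ → R) (hm : h m = h 0) :
    ∏ i ∈ Finset.range m, h (i + 1) = ∏ i ∈ Finset.range m, h i := by
  cases m with
  | zero => rfl
  | succ k => rw [Finset.prod_range_succ, Finset.prod_range_succ', hm]

end

/-! ### Arrangements of a multiset -/

/-- The words with multiset of letters `s`. -/
def arrangements (s : Multiset ℕ) : Finset (List ℕ) := s.lists.toFinset

@[simp] lemma mem_arrangements {s : Multiset ℕ} {l : List ℕ} :
    l ∈ arrangements s ↔ (l : Multiset ℕ) = s := by
  simp [arrangements, Multiset.mem_lists_iff, eq_comm]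

/-- Arrangements of `μ ::ₘ s` are split at the letter `μ`. -/
lemma sum_arrangements_cons {R : Type*} [AddCommMonoid R] {μ : ℕ} {s : Multiset ℕ} (hμ : μ ∉ s)
    (g : List ℕ → R) :
    ∑ l ∈ arrangements (μ ::ₘ s), g l = ∑ c ∈ s.antidiagonal.toFinset,
      ∑ l₁ ∈ arrangements c.1, ∑ l₂ ∈ arrangements c.2, g (l₁ ++ μ :: l₂) := by
  simp_rw [← Finset.sum_product']
  rw [Finset.sum_sigma']
  symm
  refine Finset.sum_bij (fun x _ => x.2.1 ++ μ :: x.2.2) ?_ ?_ ?_ ?_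
  · rintro ⟨⟨s₁, s₂⟩, l₁, l₂⟩ h
    simp only [Finset.mem_sigma, Multiset.mem_toFinset, Multiset.mem_antidiagonal,
      Finset.mem_product, mem_arrangements] at h ⊢
    obtain ⟨rfl, rfl, rfl⟩ := h
    rw [← Multiset.coe_add, ← Multiset.cons_coe, Multiset.add_cons]
  · rintro ⟨⟨s₁, s₂⟩, l₁, l₂⟩ h ⟨⟨t₁, t₂⟩, m₁, m₂⟩ h' heq
    simp only [Finset.mem_sigma, Multiset.mem_toFinset, Multiset.mem_antidiagonal,
      Finset.mem_product, mem_arrangements] at h h' heq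
    obtain ⟨rfl, rfl, rfl⟩ := h
    obtain ⟨h', rfl, rfl⟩ := h'
    have h1 : μ ∉ l₁ := fun hm => hμ (by simp [hm])
    have h2 : μ ∉ m₁ := fun hm => hμ (by rw [← h']; simp [hm])
    obtain ⟨rfl, rfl⟩ := append_cons_inj_of_notMem h1 h2 heq
    rfl
  · intro l hl
    rw [mem_arrangements] at hl
    have hm : μ ∈ l := by rw [← Multiset.mem_coe, hl]; simp
    obtain ⟨l₁, l₂, rfl⟩ := List.append_of_mem hm
    refine ⟨⟨(l₁, l₂), l₁, l₂⟩, ?_, rfl⟩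
    simp only [Finset.mem_sigma, Multiset.mem_toFinset, Multiset.mem_antidiagonal,
      Finset.mem_product, mem_arrangements, and_self, and_true]
    rwa [← Multiset.coe_add, ← Multiset.cons_coe, Multiset.add_cons, Multiset.cons_inj_right] at hl
  · intros
    rfl

/-- A weight of an entry by its type: peaks have weight `t`, valleys `1`, double ascents `A` and
double descents `D`. -/
def peakWeight {R : Type*} [CommRing R] (A D t : R) (p a q : ℕ) : R :=
  if p < a then (if a < q then A else t) else (if a < q then 1 else D)

section
variable {R : Type*} [CommRing R]

lemma triProd_peakWeight_congr_left (A D t : R) {p p' : ℕ} {l : List ℕ} (q : ℕ)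
    (h : ∀ a ∈ l, p < a) (h' : ∀ a ∈ l, p' < a) :
    triProd (peakWeight A D t) p l q = triProd (peakWeight A D t) p' l q := by
  cases l with
  | nil => rfl
  | cons a l => simp [triProd, peakWeight, h a, h' a]

lemma triProd_peakWeight_congr_right (A D t : R) (p : ℕ) {l : List ℕ} {q q' : ℕ}
    (h : ∀ a ∈ l, q < a) (h' : ∀ a ∈ l, q' < a) :
    triProd (peakWeight A D t) p l q = triProd (peakWeight A D t) p l q' := by
  induction l generalizing p with
  | nil => rfl
  | cons a l ih =>
    rw [triProd, triProd, ih _ (fun b hb => h b (by simp [hb])) (fun b hb => h' b (by simp [hb]))]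
    cases l with
    | nil => simp [peakWeight, (h a (by simp)).not_gt, (h' a (by simp)).not_gt]
    | cons b l => rfl

lemma triProd_peakWeight_congr (A D t : R) {l : List ℕ} {p p' q q' : ℕ}
    (hp : ∀ a ∈ l, p < a) (hp' : ∀ a ∈ l, p' < a) (hq : ∀ a ∈ l, q < a) (hq' : ∀ a ∈ l, q' < a) :
    triProd (peakWeight A D t) p l q = triProd (peakWeight A D t) p' l q' := by
  rw [triProd_peakWeight_congr_left A D t q hp hp', triProd_peakWeight_congr_right A D t p' hq hq']

/-- A nonempty multiset of distinct numbers is split at its least element. -/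
lemma exists_cons_of_nodup {s : Multiset ℕ} (hs : s.Nodup) (h0 : s ≠ 0) :
    ∃ μ s', s = μ ::ₘ s' ∧ ∀ a ∈ s', μ < a := by
  have hne : s.toFinset.Nonempty := by simpa using h0
  have hmem := Finset.min'_mem _ hne
  obtain ⟨s', hs'⟩ := Multiset.exists_cons_of_mem (Multiset.mem_toFinset.1 hmem)
  refine ⟨_, s', hs', fun a ha => lt_of_le_of_ne ?_ ?_⟩
  · exact Finset.min'_le _ _ (by rw [Multiset.mem_toFinset, hs']; simp [ha])
  · intro h
    rw [hs', Multiset.nodup_cons] at hs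
    exact hs.1 (h ▸ ha)

/-- The sum over the arrangements of a set of the product of the weights of its entries, between
two smaller letters. -/
def linearSum (A D t : R) (p : ℕ) (s : Multiset ℕ) : R :=
  ∑ l ∈ arrangements s, triProd (peakWeight A D t) p l p

lemma linearSum_zero (A D t : R) (p : ℕ) : linearSum A D t p 0 = 1 := by
  rw [linearSum, Finset.sum_eq_single []]
  · rfl
  · intro l hl h
    simp at hl
    exact absurd hl h
  · simp

lemma linearSum_cons (A D t : R) {p μ : ℕ} {s : Multiset ℕ} (hp : p < μ) (hμ : ∀ a ∈ s, μ < a) :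
    linearSum A D t p (μ ::ₘ s) = ∑ c ∈ s.antidiagonal.toFinset,
      (if c.1 = 0 then (if c.2 = 0 then t else A) else (if c.2 = 0 then D else 1)) *
        (linearSum A D t μ c.1 * linearSum A D t μ c.2) := by
  rw [linearSum, sum_arrangements_cons (fun h => (hμ μ h).false)]
  refine Finset.sum_congr rfl fun c hc => ?_
  obtain ⟨s₁, s₂⟩ := c
  rw [Multiset.mem_toFinset, Multiset.mem_antidiagonal] at hc
  simp only at hc ⊢
  rw [linearSum, linearSum, Finset.sum_mul_sum, Finset.mul_sum]
  refine Finset.sum_congr rfl fun l₁ h₁ => ?_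
  rw [Finset.mul_sum]
  refine Finset.sum_congr rfl fun l₂ h₂ => ?_
  rw [mem_arrangements] at h₁ h₂
  subst h₁ h₂ hc
  have hμ₁ : ∀ a ∈ l₁, μ < a := fun a ha => hμ a (by simp [ha])
  have hμ₂ : ∀ a ∈ l₂, μ < a := fun a ha => hμ a (by simp [ha])
  rw [triProd_append_cons, triProd_peakWeight_congr A D t (fun a ha => hp.trans (hμ₁ a ha)) hμ₁
    hμ₁ hμ₁ (p := p) (p' := μ), triProd_peakWeight_congr A D t hμ₂ hμ₂
    (fun a ha => hp.trans (hμ₂ a ha)) hμ₂ (q := p) (q' := μ)]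
  have hl : peakWeight A D t (l₁.getLastD p) μ (l₂.headD p) =
      if l₁ = [] then (if l₂ = [] then t else A) else (if l₂ = [] then D else 1) := by
    have e₂ : μ < l₂.headD p ↔ l₂ ≠ [] := by
      cases l₂ with
      | nil => simp [hp.le]
      | cons a l => simp [hμ₂ a (by simp)]
    have e₁ : l₁.getLastD p < μ ↔ l₁ = [] := by
      rcases List.eq_nil_or_concat l₁ with rfl | ⟨l, a, rfl⟩
      · simp [hp]
      · rw [List.concat_eq_append, getLastD_append_cons]
        simpa using (hμ₁ a (by simp)).le
    unfold peakWeight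
    simp only [e₁, e₂]
    split_ifs <;> tauto
  rw [hl]
  simp only [Multiset.coe_eq_zero]
  ring

/-- The sum over the linear arrangements depends on the weights of the double ascents and of the
double descents through their sum only. -/
lemma linearSum_eq_of_add_eq {A D A' D' : R} (t : R) (h : A + D = A' + D') (N : ℕ) :
    ∀ (s : Multiset ℕ) (p : ℕ), s.card = N → s.Nodup → (∀ a ∈ s, p < a) →
      linearSum A D t p s = linearSum A' D' t p s := by
  induction N using Nat.strong_induction_on with
  | _ N ih =>
    intro s p hN hs hp
    rcases eq_or_ne s 0 with rfl | h0
    · simp [linearSum_zero]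
    obtain ⟨μ, s, rfl, hμ⟩ := exists_cons_of_nodup hs h0
    rw [linearSum_cons A D t (hp μ (by simp)) hμ, linearSum_cons A' D' t (hp μ (by simp)) hμ]
    have key : ∀ c : Multiset ℕ × Multiset ℕ, c.1 + c.2 = s →
        linearSum A D t μ c.1 = linearSum A' D' t μ c.1 ∧
        linearSum A D t μ c.2 = linearSum A' D' t μ c.2 := by
      rintro ⟨s₁, s₂⟩ rfl
      simp only [Multiset.card_cons, Multiset.card_add] at hN
      rw [Multiset.nodup_cons, Multiset.nodup_add] at hs
      exact ⟨ih s₁.card (by omega) s₁ μ rfl hs.2.1 fun a ha => hμ a (by simp [ha]),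
        ih s₂.card (by omega) s₂ μ rfl hs.2.2.1 fun a ha => hμ a (by simp [ha])⟩
    rcases eq_or_ne s 0 with rfl | hs0
    · simp [linearSum_zero]
    have m₁ : ((0 : Multiset ℕ), s) ∈ s.antidiagonal.toFinset := by simp
    have m₂ : (s, (0 : Multiset ℕ)) ∈ s.antidiagonal.toFinset.erase (0, s) := by simp [hs0]
    rw [← Finset.add_sum_erase _ _ m₁, ← Finset.add_sum_erase _ _ m₁,
      ← Finset.add_sum_erase _ _ m₂, ← Finset.add_sum_erase _ _ m₂, ← add_assoc, ← add_assoc]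
    congr 1
    · have := (key (s, 0) (by simp)).1
      simp only [if_true, hs0, if_false, linearSum_zero] at this ⊢
      rw [this]
      linear_combination linearSum A' D' t μ s * h
    · refine Finset.sum_congr rfl fun c hc => ?_
      simp only [Finset.mem_erase, Multiset.mem_toFinset, Multiset.mem_antidiagonal] at hc
      obtain ⟨s₁, s₂⟩ := c
      have e := key _ hc.2.2
      have n₁ : s₁ ≠ 0 := by
        rintro rfl
        exact hc.2.1 (by simpa using hc.2.2)
      have n₂ : s₂ ≠ 0 := by
        rintro rfl
        exact hc.1 (by simpa using hc.2.2)
      simp only [n₁, n₂, if_false] at e ⊢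
      rw [e.1, e.2]

lemma cycProd_peakWeight_of_lt (A D t : R) {v : ℕ} {l : List ℕ} (h0 : l ≠ [])
    (h : ∀ a ∈ l, v < a) :
    cycProd (peakWeight A D t) v l = triProd (peakWeight A D t) v l v := by
  have e₁ : v < l.headD v := by
    cases l with
    | nil => exact absurd rfl h0
    | cons a l => exact h a (by simp)
  have e₂ : ¬ l.getLastD v < v := by
    rcases List.eq_nil_or_concat l with rfl | ⟨l, a, rfl⟩
    · simp
    · rw [List.concat_eq_append, getLastD_append_cons]
      simpa using (h a (by simp)).le
  simp only [cycProd, peakWeight, e₁, e₂, if_true, if_false, one_mul]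

lemma sum_cycProd_cons (F : ℕ → ℕ → ℕ → R) {v μ : ℕ} {s : Multiset ℕ} (hv : v ∉ s) (hμ : μ ∉ s) :
    ∑ l ∈ arrangements (μ ::ₘ s), cycProd F v l = ∑ l ∈ arrangements (v ::ₘ s), cycProd F μ l := by
  rw [sum_arrangements_cons hμ, sum_arrangements_cons hv]
  refine Finset.sum_nbij' Prod.swap Prod.swap ?_ ?_ ?_ ?_ ?_
  · simp [add_comm]
  · simp [add_comm]
  · simp
  · simp
  · intro c _
    simp only [Prod.fst_swap, Prod.snd_swap]
    rw [Finset.sum_comm]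
    refine Finset.sum_congr rfl fun l₂ _ => Finset.sum_congr rfl fun l₁ _ => ?_
    exact cycProd_rotate F v l₁ μ l₂

/-- The sum over the cyclic arrangements depends on the weights of the double ascents and of the
double descents through their sum only. -/
lemma sum_cycProd_eq_of_add_eq {A D A' D' : R} (t : R) (h : A + D = A' + D') {v : ℕ}
    {s : Multiset ℕ} (hs : s.Nodup) (h0 : s ≠ 0) (hv : v ∉ s) :
    ∑ l ∈ arrangements s, cycProd (peakWeight A D t) v l =
      ∑ l ∈ arrangements s, cycProd (peakWeight A' D' t) v l := by
  have main : ∀ (v : ℕ) (s : Multiset ℕ), s.Nodup → s ≠ 0 → (∀ a ∈ s, v < a) →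
      ∑ l ∈ arrangements s, cycProd (peakWeight A D t) v l =
        ∑ l ∈ arrangements s, cycProd (peakWeight A' D' t) v l := by
    intro v s hs h0 hv
    have := linearSum_eq_of_add_eq t h _ s v rfl hs hv
    unfold linearSum at this
    refine Eq.trans ?_ (this.trans ?_) <;> refine Finset.sum_congr rfl fun l hl => ?_ <;>
      rw [mem_arrangements] at hl <;> subst hl <;> rw [cycProd_peakWeight_of_lt] <;>
      simp_all
  obtain ⟨μ, s, rfl, hμ⟩ := exists_cons_of_nodup hs h0
  by_cases hvμ : v < μ
  · exact main v _ hs h0 (by simpa [hvμ] using fun a ha => hvμ.trans (hμ a ha))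
  · rw [Multiset.nodup_cons] at hs
    rw [Multiset.mem_cons, not_or] at hv
    rw [sum_cycProd_cons _ hv.2 hs.1, sum_cycProd_cons _ hv.2 hs.1]
    exact main μ _ (Multiset.nodup_cons.2 ⟨hv.2, hs.2⟩) (by simp)
      (by simpa using ⟨by omega, hμ⟩)

end

/-! ### Statistics of words as products of local weights -/

/-- The weight of two adjacent letters: `x` for an ascent, `y` for a descent and `z` for a
plateau. -/
def stepWeight {R : Type*} (x y z : R) (a b : ℕ) : R :=
  if a < b then x else if b < a then y else z

lemma pairProd_stepWeight_zero {R : Type*} [CommMonoid R] (x y z : R) (π : List ℕ) :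
    pairProd (stepWeight x y z) 0 π 0 = x ^ asc π * y ^ des π * z ^ plat π := by
  have h : ∀ a b : ℕ, stepWeight x y z a b = (if a < b then x else 1) * (if a > b then y else 1) *
      (if a = b then z else 1) := by
    intro a b
    unfold stepWeight
    split_ifs <;> first | omega | simp
  rw [← prod_range_eq_pairProd]
  simp only [h, Finset.prod_mul_distrib, Finset.prod_ite, Finset.prod_const_one, mul_one,
    Finset.prod_const]
  rfl

lemma cyclicEntry_ne_succ {w : List ℕ} (hw : w.Nodup) (h2 : 2 ≤ w.length) (i : ℕ) :
    cyclicEntry w i ≠ cyclicEntry w (i + 1) := by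
  have h : ∀ i, i % w.length < w.length := fun i => Nat.mod_lt _ (by omega)
  unfold cyclicEntry
  rw [List.getD_eq_getElem _ _ (h _), List.getD_eq_getElem _ _ (h _), Ne, hw.getElem_inj_iff]
  intro e
  have : (i : ℕ) ≡ i + 1 [MOD w.length] := e
  have := (Nat.modEq_iff_dvd' (by omega)).1 this
  rw [show i + 1 - i = 1 by omega, Nat.dvd_one] at this
  omega

lemma cyclicEntry_pred_succ (w : List ℕ) (h : w ≠ []) (i : ℕ) :
    cyclicEntry w (i + w.length - 1 + 1) = cyclicEntry w i := by
  have := List.length_pos_iff.2 h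
  rw [show i + w.length - 1 + 1 = i + w.length by omega, cyclicEntry_add_length]

lemma cyclicEntry_ne_pred {w : List ℕ} (hw : w.Nodup) (h2 : 2 ≤ w.length) (i : ℕ) :
    cyclicEntry w (i + w.length - 1) ≠ cyclicEntry w i := by
  rw [← cyclicEntry_pred_succ w (by rintro rfl; simp at h2) i]
  exact cyclicEntry_ne_succ hw h2 _

/-- The cyclic predecessors and the cyclic successors give the same number of cyclic ascents. -/
@[to_additive sum_range_cyclicEntry_pred]
lemma prod_range_cyclicEntry_pred {R : Type*} [CommMonoid R] (g : ℕ → ℕ → R) {w : List ℕ}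
    (h : w ≠ []) :
    ∏ i ∈ Finset.range w.length, g (cyclicEntry w (i + w.length - 1)) (cyclicEntry w i) =
      ∏ i ∈ Finset.range w.length, g (cyclicEntry w i) (cyclicEntry w (i + 1)) := by
  have hp := List.length_pos_iff.2 h
  rw [← prod_range_succ_eq
    (fun i => g (cyclicEntry w (i + w.length - 1)) (cyclicEntry w i))]
  · refine Finset.prod_congr rfl fun i _ => ?_
    rw [show i + 1 + w.length - 1 = i + w.length by omega, cyclicEntry_add_length]
  · have h₁ := cyclicEntry_add_length w 0
    have h₂ := cyclicEntry_add_length w (w.length - 1)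
    rw [show w.length - 1 + w.length = w.length + w.length - 1 by omega] at h₂
    simp only [zero_add] at h₁ ⊢
    rw [h₁, h₂]

lemma pairProd_stepWeight_of_nodup {R : Type*} [CommRing R] (x y z : R) {v : ℕ} {l : List ℕ}
    (h0 : l ≠ []) (hl : (v :: l).Nodup) :
    pairProd (stepWeight x y z) v l v = cycProd (peakWeight x y (x * y)) v l := by
  have h2 : 2 ≤ (v :: l).length := by
    have := List.length_pos_iff.2 h0
    simp only [List.length_cons]
    omega
  rw [pairProd_eq_cycProd, ← prod_range_eq_cycProd, ← prod_range_eq_cycProd]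
  have e₁ : ∀ i, stepWeight x y z (cyclicEntry (v :: l) i) (cyclicEntry (v :: l) (i + 1)) =
      (if cyclicEntry (v :: l) i < cyclicEntry (v :: l) (i + 1) then x else 1) *
      (if cyclicEntry (v :: l) i < cyclicEntry (v :: l) (i + 1) then 1 else y) := by
    intro i
    have := cyclicEntry_ne_succ hl h2 i
    unfold stepWeight
    split_ifs <;> first | omega | simp
  have e₂ : ∀ p a q, peakWeight x y (x * y) p a q =
      (if p < a then x else 1) * (if a < q then 1 else y) := by
    intro p a q
    unfold peakWeight
    split_ifs <;> simp
  simp only [e₁, e₂, Finset.prod_mul_distrib]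
  rw [prod_range_cyclicEntry_pred (fun a b => if a < b then x else 1) (by simp)]

lemma two_le_length_cons {v : ℕ} {l : List ℕ} (h0 : l ≠ []) : 2 ≤ (v :: l).length := by
  have := List.length_pos_iff.2 h0
  simp only [List.length_cons]
  omega

/-- In a word without double cyclic descents, every cyclic descent starts at a peak. -/
lemma wordCdes_add_card_doubleAscents {w : List ℕ} (hw : w.Nodup) (h2 : 2 ≤ w.length)
    (hd : ∀ i < w.length, ¬ IsDoubleCyclicDescent w i) :
    2 * wordCdes w + ((Finset.range w.length).filter fun i =>
      cyclicEntry w (i + w.length - 1) < cyclicEntry w i ∧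
        cyclicEntry w i < cyclicEntry w (i + 1)).card = w.length := by
  have hne : w ≠ [] := by
    rintro rfl
    simp at h2
  have c₁ : ((Finset.range w.length).filter fun i =>
      cyclicEntry w (i + w.length - 1) < cyclicEntry w i).card =
      ((Finset.range w.length).filter fun i => cyclicEntry w i < cyclicEntry w (i + 1)).card := by
    simp only [Finset.card_filter]
    exact sum_range_cyclicEntry_pred (fun a b => if a < b then 1 else 0) hne
  have c₂ := Finset.card_filter_add_card_filter_not (s := Finset.range w.length)
    (fun i => cyclicEntry w i > cyclicEntry w (i + 1))
  have c₃ := Finset.card_filter_add_card_filter_not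
    (s := (Finset.range w.length).filter fun i => cyclicEntry w (i + w.length - 1) < cyclicEntry w i)
    (fun i => cyclicEntry w i > cyclicEntry w (i + 1))
  rw [Finset.filter_filter, Finset.filter_filter] at c₃
  have e₁ : ((Finset.range w.length).filter fun i => ¬ cyclicEntry w i > cyclicEntry w (i + 1)) =
      ((Finset.range w.length).filter fun i => cyclicEntry w i < cyclicEntry w (i + 1)) :=
    Finset.filter_congr fun i _ => by
      have := cyclicEntry_ne_succ hw h2 i
      omega
  have e₂ : ((Finset.range w.length).filter fun i =>
      cyclicEntry w (i + w.length - 1) < cyclicEntry w i ∧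
        ¬ cyclicEntry w i > cyclicEntry w (i + 1)) =
      ((Finset.range w.length).filter fun i =>
      cyclicEntry w (i + w.length - 1) < cyclicEntry w i ∧
        cyclicEntry w i < cyclicEntry w (i + 1)) :=
    Finset.filter_congr fun i _ => by
      have := cyclicEntry_ne_succ hw h2 i
      omega
  have e₃ : ((Finset.range w.length).filter fun i =>
      cyclicEntry w (i + w.length - 1) < cyclicEntry w i ∧
        cyclicEntry w i > cyclicEntry w (i + 1)) =
      ((Finset.range w.length).filter fun i => cyclicEntry w i > cyclicEntry w (i + 1)) :=
    Finset.filter_congr fun i hi => by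
      have := cyclicEntry_ne_pred hw h2 i
      have := hd i (Finset.mem_range.1 hi)
      unfold IsDoubleCyclicDescent at this
      omega
  rw [e₁, Finset.card_range] at c₂
  rw [e₂, e₃, c₁] at c₃
  unfold wordCdes
  omega

lemma cycProd_peakWeight_eq_ite {R : Type*} [CommRing R] (s t : R) {v : ℕ} {l : List ℕ}
    (h0 : l ≠ []) (hl : (v :: l).Nodup) :
    cycProd (peakWeight s 0 t) v l =
      if ∀ i < (v :: l).length, ¬ IsDoubleCyclicDescent (v :: l) i then
        t ^ wordCdes (v :: l) * s ^ ((v :: l).length - 2 * wordCdes (v :: l)) else 0 := by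
  have h2 := two_le_length_cons (v := v) h0
  rw [← prod_range_eq_cycProd]
  split_ifs with hd
  · have hc := wordCdes_add_card_doubleAscents hl h2 hd
    rw [← Nat.eq_sub_of_add_eq' hc, wordCdes]
    simp only [← Finset.prod_const, Finset.prod_filter]
    rw [← Finset.prod_mul_distrib]
    refine Finset.prod_congr rfl fun i hi => ?_
    have h₁ := cyclicEntry_ne_succ hl h2 i
    have h₂ := cyclicEntry_ne_pred hl h2 i
    have h₃ := hd i (Finset.mem_range.1 hi)
    unfold IsDoubleCyclicDescent at h₃
    unfold peakWeight
    split_ifs <;> first | omega | simp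
  · push Not at hd
    obtain ⟨i, hi, h₁, h₂⟩ := hd
    refine Finset.prod_eq_zero (Finset.mem_range.2 hi) ?_
    rw [peakWeight, if_neg h₁.not_gt, if_neg h₂.not_gt]

lemma wordCdes_replicate (m a : ℕ) : wordCdes (List.replicate m a) = 0 := by
  rw [wordCdes, Finset.card_eq_zero, Finset.filter_eq_empty_iff]
  intro i hi
  have hi := Finset.mem_range.1 hi
  have h : ∀ j, cyclicEntry (List.replicate m a) j = a := by
    intro j
    have hj : j % (List.replicate m a).length < (List.replicate m a).length :=
      Nat.mod_lt _ (by omega)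
    rw [cyclicEntry, List.getD_eq_getElem _ _ hj]
    simp
  simp [h]

lemma one_le_wordCdes {v : ℕ} {l : List ℕ} (h0 : l ≠ []) (hl : ∀ a ∈ l, v < a) :
    1 ≤ wordCdes (v :: l) := by
  refine Finset.card_pos.2 ⟨l.length, ?_⟩
  rw [Finset.mem_filter, cyclicEntry_length,
    show cyclicEntry (v :: l) (l.length + 1) = v by
      rw [cyclicEntry_eq_getD _ _ _ le_rfl]; simp]
  refine ⟨by simp, ?_⟩
  rcases List.eq_nil_or_concat l with rfl | ⟨l, a, rfl⟩
  · exact absurd rfl h0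
  · rw [List.concat_eq_append, getLastD_append_cons]
    exact hl a (by simp)

/-- The two weights of a word with distinct letters `v :: l` have the same sum over the
arrangements of `l`. -/
lemma sum_pairProd_stepWeight {R : Type*} [CommRing R] (x y z : R) {v : ℕ} {s : Multiset ℕ}
    (hs : s.Nodup) (hv : v ∉ s) :
    ∑ l ∈ arrangements s, pairProd (stepWeight x y z) v l v = ∑ l ∈ arrangements s,
      if l = [] then z else cycProd (peakWeight (x + y) 0 (x * y)) v l := by
  rcases eq_or_ne s 0 with rfl | h0
  · refine Finset.sum_congr rfl fun l hl => ?_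
    have : l = [] := by simpa using hl
    simp [this, pairProd, stepWeight]
  · have hne : ∀ l ∈ arrangements s, l ≠ [] := by
      rintro l hl rfl
      exact h0 (mem_arrangements.1 hl).symm
    refine Eq.trans (Finset.sum_congr rfl fun l hl => ?_)
      ((sum_cycProd_eq_of_add_eq (x * y) (add_zero (x + y)).symm hs h0 hv).trans
        (Finset.sum_congr rfl fun l hl => ?_))
    · have h := hne l hl
      rw [mem_arrangements] at hl
      subst hl
      exact pairProd_stepWeight_of_nodup x y z h (List.nodup_cons.2 ⟨hv, hs⟩)
    · rw [if_neg (hne l hl)]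

namespace OTree

/-! ### Subtrees at even and at odd levels -/

lemma sizeOf_lt_of_mem_children {t e : OTree} (h : e ∈ t.children) : sizeOf e < sizeOf t := by
  cases t with
  | node a ts =>
    have := List.sizeOf_lt_of_mem h
    simp only [children, node.sizeOf_spec] at this ⊢
    omega

/-- Induction over two levels of a tree. -/
lemma induction_grandchildren {P : OTree → Prop}
    (h : ∀ v ts, (∀ t ∈ ts, ∀ e ∈ t.children, P e) → P (node v ts)) (T : OTree) : P T := by
  induction hn : sizeOf T using Nat.strong_induction_on generalizing T with
  | _ n ih =>
    subst hn
    cases T with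
    | node v ts =>
      refine h v ts fun t ht e he => ih _ ?_ e rfl
      exact (sizeOf_lt_of_mem_children he).trans
        (sizeOf_lt_of_mem_children (t := node v ts) (by exact ht))

/-- The subtrees at the vertices whose level has the same parity as the level of the root
(for `true`), or the opposite parity (for `false`). -/
def subtreesOfParity : Bool → OTree → List OTree
  | b, node a ts => (if b then [node a ts] else []) ++
      ts.attach.flatMap fun t => subtreesOfParity (!b) t.1
termination_by _ t => sizeOf t
decreasing_by
  have h := List.sizeOf_lt_of_mem t.2
  simp only [node.sizeOf_spec]
  omega

lemma flatMap_attach {α β : Type*} (l : List α) (f : α → List β) :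
    (l.attach.flatMap fun t => f t.1) = l.flatMap f := by
  rw [← List.flatMap_map (f := Subtype.val) (g := f), List.attach_map_subtype_val]

lemma subtreesOfParity_node (b : Bool) (a : ℕ) (ts : List OTree) :
    subtreesOfParity b (node a ts) =
      (if b then [node a ts] else []) ++ ts.flatMap (subtreesOfParity !b) := by
  rw [subtreesOfParity, flatMap_attach]

lemma verticesFrom_node (d a : ℕ) (ts : List OTree) :
    verticesFrom d (node a ts) = (d, node a ts) :: ts.flatMap (verticesFrom (d + 1)) := by
  rw [verticesFrom, flatMap_attach]

/-- The subtrees at the vertices of even level. -/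
def evens (T : OTree) : List OTree := subtreesOfParity true T

/-- The subtrees at the vertices of odd level. -/
def odds (T : OTree) : List OTree := subtreesOfParity false T

lemma evens_node (a : ℕ) (ts : List OTree) :
    evens (node a ts) = node a ts :: ts.flatMap fun t => t.children.flatMap evens := by
  simp only [evens, subtreesOfParity_node, if_true, Bool.not_true, List.singleton_append]
  congr 2
  funext t
  cases t with
  | node i es => simp [subtreesOfParity_node, children]; rfl

lemma odds_node (a : ℕ) (ts : List OTree) :
    odds (node a ts) = ts.flatMap fun t => t :: t.children.flatMap odds := by
  simp only [odds, subtreesOfParity_node, Bool.not_false, Bool.false_eq_true, if_false,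
    List.nil_append]
  congr 1
  funext t
  cases t with
  | node i es => simp [subtreesOfParity_node, children]; rfl

lemma filter_verticesFrom (b : Bool) (T : OTree) : ∀ d,
    ((verticesFrom d T).filter fun v => decide (Even v.1) == b).map Prod.snd =
      subtreesOfParity (decide (Even d) == b) T := by
  induction hn : sizeOf T using Nat.strong_induction_on generalizing T with
  | _ n ih =>
    subst hn
    intro d
    cases T with
    | node a ts =>
      rw [verticesFrom_node, subtreesOfParity_node, List.filter_cons, List.filter_flatMap]
      have h : (!(decide (Even d) == b)) = (decide (Even (d + 1)) == b) := by
        rw [decide_eq_decide.2 Nat.even_add_one, decide_not]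
        cases decide (Even d) <;> cases b <;> rfl
      have hts : (ts.flatMap fun t => (verticesFrom (d + 1) t).filter fun v =>
          decide (Even v.1) == b).map Prod.snd =
            ts.flatMap (subtreesOfParity !(decide (Even d) == b)) := by
        rw [List.map_flatMap, h]
        refine List.flatMap_congr fun t ht => ?_
        exact ih _ (sizeOf_lt_of_mem_children (t := node a ts) ht) t rfl (d + 1)
      rw [← hts]
      cases hb : (decide (Even d) == b) <;> simp

lemma filter_even_vertices (T : OTree) :
    (T.vertices.filter fun v => decide (Even v.1)).map Prod.snd = T.evens := by
  simpa [vertices, evens] using filter_verticesFrom true T 0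

lemma filter_odd_vertices (T : OTree) :
    (T.vertices.filter fun v => !decide (Even v.1)).map Prod.snd = T.odds := by
  simpa [vertices, odds] using filter_verticesFrom false T 0

/-- Every vertex at odd level with label `i` has `κ i` children, all of them with label `i`. -/
def Valid (κ : ℕ → ℕ) (T : OTree) : Prop :=
  ∀ u ∈ T.odds, u.children.length = κ u.label ∧ ∀ c ∈ u.children, c.label = u.label

lemma valid_node {κ : ℕ → ℕ} {a : ℕ} {ts : List OTree} :
    Valid κ (node a ts) ↔ ∀ t ∈ ts, (t.children.length = κ t.label ∧
      ∀ c ∈ t.children, c.label = t.label) ∧ ∀ e ∈ t.children, Valid κ e := by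
  simp only [Valid, odds_node, List.mem_flatMap, List.mem_cons]
  constructor
  · intro h t ht
    exact ⟨h t ⟨t, ht, .inl rfl⟩, fun e he u hu => h u ⟨t, ht, .inr ⟨e, he, hu⟩⟩⟩
  · rintro h u ⟨t, ht, rfl | ⟨e, he, hu⟩⟩
    · exact (h u ht).1
    · exact (h t ht).2 e he u hu

lemma forall_vertices_odd_iff {P : OTree → Prop} (T : OTree) :
    (∀ v ∈ T.vertices, Odd v.1 → P v.2) ↔ ∀ u ∈ T.odds, P u := by
  rw [← filter_odd_vertices]
  simp only [List.mem_map, List.mem_filter, Bool.not_eq_true', decide_eq_false_iff_not,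
    Nat.not_even_iff_odd]
  constructor
  · rintro h _ ⟨v, ⟨hv, ho⟩, rfl⟩
    exact h v hv ho
  · exact fun h v hv ho => h _ ⟨v, ⟨hv, ho⟩, rfl⟩

/-! ### The word of a tree -/

/-- The word read off from a tree by walking around it: the concatenation over the children of the
root, labeled `i` and with the subtrees `e₁, …, e_m`, of the blocks `i w₁ i w₂ i ⋯ w_m i`, where
`w_j` is the word of `e_j`. -/
def toWord : OTree → List ℕ
  | node _ ts => ts.attach.flatMap fun t =>
      t.1.label :: t.1.children.attach.flatMap fun e => toWord e.1 ++ [t.1.label]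
termination_by t => sizeOf t
decreasing_by
  have h := List.sizeOf_lt_of_mem t.2
  have h' := sizeOf_lt_of_mem_children e.2
  simp only [node.sizeOf_spec]
  omega

/-- The part of the block of a vertex labeled `i` that follows its first letter. -/
def blockTail (i : ℕ) (es : List OTree) : List ℕ := es.flatMap fun e => toWord e ++ [i]

lemma toWord_node (v : ℕ) (ts : List OTree) :
    toWord (node v ts) = ts.flatMap fun t => t.label :: blockTail t.label t.children := by
  rw [toWord, ← flatMap_attach ts fun t => t.label :: blockTail t.label t.children]
  simp only [blockTail, ← flatMap_attach _ fun e => toWord e ++ _]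

lemma toWord_node_nil (v : ℕ) : toWord (node v []) = [] := by
  simp [toWord_node]

lemma toWord_node_cons (v : ℕ) (t : OTree) (ts : List OTree) :
    toWord (node v (t :: ts)) = t.label :: blockTail t.label t.children ++ toWord (node v ts) := by
  simp [toWord_node]

lemma blockTail_cons (i : ℕ) (e : OTree) (es : List OTree) :
    blockTail i (e :: es) = toWord e ++ i :: blockTail i es := by
  simp [blockTail]

lemma count_blockTail (i j : ℕ) (es : List OTree) : (blockTail i es).count j =
    (es.map fun e => (toWord e).count j).sum + if i = j then es.length else 0 := by
  induction es with
  | nil => simp [blockTail]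
  | cons e es ih =>
    rw [blockTail_cons, List.count_append, List.count_cons, ih, List.map_cons, List.sum_cons,
      List.length_cons]
    simp only [beq_iff_eq]
    split_ifs <;> omega

lemma count_toWord {κ : ℕ → ℕ} (j : ℕ) (T : OTree) (hT : Valid κ T) :
    (toWord T).count j = (κ j + 1) * (T.odds.map label).count j := by
  induction T using induction_grandchildren with
  | h v ts ih =>
    rw [valid_node] at hT
    rw [toWord_node, odds_node, List.map_flatMap, List.count_flatMap, List.count_flatMap,
      ← List.sum_map_mul_left]
    congr 1
    refine List.map_congr_left fun t ht => ?_
    obtain ⟨⟨hl, -⟩, hv⟩ := hT t ht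
    simp only [Function.comp, List.map_cons, List.count_cons, count_blockTail, List.map_flatMap,
      List.count_flatMap, beq_iff_eq]
    rw [List.map_congr_left fun e he => ih t ht e he (hv e he), List.sum_map_mul_left, hl]
    simp only [Function.comp_def]
    split_ifs with h
    · rw [h]; ring
    · ring

lemma count_evens {κ : ℕ → ℕ} (j : ℕ) (T : OTree) (hT : Valid κ T) :
    (T.evens.map label).count j =
      κ j * (T.odds.map label).count j + if T.label = j then 1 else 0 := by
  induction T using induction_grandchildren with
  | h v ts ih =>
    rw [valid_node] at hT
    rw [evens_node, odds_node, List.map_flatMap, List.map_cons, List.map_flatMap, List.count_cons,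
      List.count_flatMap, List.count_flatMap, ← List.sum_map_mul_left]
    simp only [label, beq_iff_eq]
    congr 2
    refine List.map_congr_left fun t ht => ?_
    obtain ⟨⟨hl, hc⟩, hv⟩ := hT t ht
    simp only [Function.comp, List.map_cons, List.count_cons, List.map_flatMap,
      List.count_flatMap, beq_iff_eq]
    rw [mul_add, ← List.sum_map_mul_left, List.map_congr_left (g := fun e =>
      κ j * (e.odds.map label).count j + if t.label = j then 1 else 0)
      fun e he => by rw [← hc e he]; exact ih t ht e he (hv e he)]
    rw [List.sum_map_add]
    congr 1
    split_ifs with h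
    · simp [hl, h]
    · simp

lemma count_label_vertices (j : ℕ) (T : OTree) :
    (T.vertices.map fun v => v.2.label).count j =
      (T.evens.map label).count j + (T.odds.map label).count j := by
  rw [← filter_even_vertices, ← filter_odd_vertices, List.map_map, List.map_map]
  generalize T.vertices = l
  induction l with
  | nil => rfl
  | cons v l ih =>
    by_cases h : Even v.1
    · simp only [List.map_cons, List.count_cons, List.filter_cons, h, ih, decide_true,
        Bool.not_true, if_true, Bool.false_eq_true, if_false, Function.comp]
      omega
    · simp only [List.map_cons, List.count_cons, List.filter_cons, h, ih, decide_false,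
        Bool.not_false, if_true, Bool.false_eq_true, if_false, Function.comp]
      omega

lemma coe_label_vertices {κ : ℕ → ℕ} {T : OTree} (hT : Valid κ T) :
    ((T.vertices.map fun v => v.2.label : List ℕ) : Multiset ℕ) =
      T.label ::ₘ (toWord T : Multiset ℕ) := by
  ext j
  rw [Multiset.coe_count, Multiset.count_cons, Multiset.coe_count, count_label_vertices,
    count_evens j T hT, count_toWord j T hT]
  simp only [eq_comm (a := j)]
  ring

end OTree

open OTree

/-- The number of children of a vertex at odd level in the trees of `𝒯_M`, in terms of its
label. -/
def oddDegree (M : Multiset ℕ) (i : ℕ) : ℕ := M.count i - 1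

lemma mem_trees_iff {M : Multiset ℕ} {T : OTree} :
    T ∈ trees M ↔ T.label = 0 ∧ Valid (oddDegree M) T ∧ (toWord T : Multiset ℕ) = M := by
  have h := forall_vertices_odd_iff (P := fun u => u.children.length = M.count u.label - 1 ∧
      ∀ c ∈ u.children, c.label = u.label) T
  unfold trees
  rw [Set.mem_ofPred_eq, h]
  change _ ∧ _ ∧ Valid (oddDegree M) T ↔ _
  constructor
  · rintro ⟨h₁, h₂, h₃⟩
    rw [coe_label_vertices h₃, h₂, Multiset.cons_inj_right] at h₁
    exact ⟨h₂, h₃, h₁⟩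
  · rintro ⟨h₂, h₃, h₁⟩
    refine ⟨?_, h₂, h₃⟩
    rw [coe_label_vertices h₃, h₂, h₁]

lemma count_odds_of_mem_trees {M : Multiset ℕ} {T : OTree} (hT : T ∈ trees M) (j : ℕ) :
    (T.odds.map label).count j = if j ∈ M then 1 else 0 := by
  obtain ⟨-, hv, hw⟩ := mem_trees_iff.1 hT
  have h := count_toWord j T hv
  rw [← Multiset.coe_count, hw, oddDegree] at h
  split_ifs with hj
  · have := Multiset.count_pos.2 hj
    rw [Nat.sub_add_cancel this] at h
    exact (Nat.eq_of_mul_eq_mul_left this (by rw [mul_one]; exact h)).symm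
  · rw [Multiset.count_eq_zero_of_notMem hj] at h
    simpa using h.symm

lemma coe_odds_of_mem_trees {M : Multiset ℕ} {T : OTree} (hT : T ∈ trees M) :
    ((T.odds.map label : List ℕ) : Multiset ℕ) = M.dedup := by
  ext j
  rw [Multiset.coe_count, count_odds_of_mem_trees hT, Multiset.count_dedup]

/-! ### Quasi-Stirling words and trees -/

/-- The words without a subword `a b a b` for distinct letters `a` and `b`. -/
def AvoidsAlternation (π : List ℕ) : Prop :=
  ∀ a b : ℕ, a ≠ b → ¬ [a, b, a, b].Sublist π

lemma isQuasiStirling_iff (π : List ℕ) : IsQuasiStirling π ↔ AvoidsAlternation π := by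
  unfold IsQuasiStirling AvoidsAlternation
  constructor
  · rintro h a b hab hs
    obtain ⟨f, hf⟩ := List.sublist_iff_exists_fin_orderEmbedding_get_eq.1 hs
    have hlt : ∀ m n : Fin 4, m < n → (show Fin [a, b, a, b].length from m) < n := fun _ _ h => h
    refine h ⟨f 0, f 1, f 2, f 3, f.lt_iff_lt.2 (hlt 0 1 (by decide)),
      f.lt_iff_lt.2 (hlt 1 2 (by decide)),
      f.lt_iff_lt.2 (hlt 2 3 (by decide)), ?_, ?_, ?_⟩
    · rw [← hf, ← hf]; rfl
    · rw [← hf, ← hf]; rfl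
    · rw [← hf, ← hf]; exact hab
  · rintro h ⟨i, j, k, l, hij, hjk, hkl, e₁, e₂, hne⟩
    refine h _ _ hne (List.sublist_iff_exists_fin_orderEmbedding_get_eq.2
      ⟨OrderEmbedding.ofStrictMono ![i, j, k, l] ?_, ?_⟩)
    · refine Fin.strictMono_iff_lt_succ.2 fun m => ?_
      fin_cases m <;> assumption
    · intro m
      fin_cases m
      · rfl
      · rfl
      · exact e₁
      · exact e₂

lemma AvoidsAlternation.of_sublist {l m : List ℕ} (h : AvoidsAlternation m) (hl : l.Sublist m) :
    AvoidsAlternation l :=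
  fun a b hab hs => h a b hab (hs.trans hl)

/-- Splittings of an alternating subword. -/
lemma alternation_sublist_append {a b : ℕ} {l m : List ℕ} (h : [a, b, a, b].Sublist (l ++ m)) :
    [a, b, a, b].Sublist m ∨ (a ∈ l ∧ [b, a, b].Sublist m) ∨
      ([a, b].Sublist l ∧ b ∈ m) ∨ [a, b, a, b].Sublist l := by
  obtain ⟨p, q, e, hp, hq⟩ := List.sublist_append_iff.1 h
  match p, e with
  | [], e => exact .inl (by rw [List.nil_append] at e; rw [e]; exact hq)
  | [_], e =>
    obtain ⟨rfl, rfl⟩ := List.cons.inj e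
    exact .inr (.inl ⟨by simpa using hp, hq⟩)
  | [_, _], e =>
    simp only [List.cons_append, List.nil_append, List.cons.injEq] at e
    obtain ⟨rfl, rfl, rfl⟩ := e
    exact .inr (.inr (.inl ⟨hp, hq.subset (by simp)⟩))
  | [_, _, _], e =>
    simp only [List.cons_append, List.nil_append, List.cons.injEq] at e
    obtain ⟨rfl, rfl, rfl, rfl⟩ := e
    exact .inr (.inr (.inl ⟨List.Sublist.trans (by simp) hp, hq.subset (by simp)⟩))
  | [_, _, _, _], e =>
    simp only [List.cons_append, List.nil_append, List.cons.injEq] at e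
    obtain ⟨rfl, rfl, rfl, rfl, -⟩ := e
    exact .inr (.inr (.inr hp))
  | _ :: _ :: _ :: _ :: _ :: _, e => simp at e

lemma AvoidsAlternation.append {l m : List ℕ} (hl : AvoidsAlternation l) (hm : AvoidsAlternation m)
    (hd : l.Disjoint m) : AvoidsAlternation (l ++ m) := by
  intro a b hab h
  rcases alternation_sublist_append h with h | ⟨h, h'⟩ | ⟨h, h'⟩ | h
  · exact hm a b hab h
  · exact hd h (h'.subset (by simp))
  · exact hd (h.subset (by simp)) h'
  · exact hl a b hab h

lemma AvoidsAlternation.cons_append_cons {i : ℕ} {l m : List ℕ} (hl : AvoidsAlternation l)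
    (hm : AvoidsAlternation (i :: m)) (hi : i ∉ l) (hd : l.Disjoint m) :
    AvoidsAlternation (i :: l ++ i :: m) := by
  intro a b hab h
  have key : b ∈ l → b ∈ i :: m → False := by
    intro h₁ h₂
    rcases List.mem_cons.1 h₂ with rfl | h₂
    · exact hi h₁
    · exact hd h₁ h₂
  have second : ∀ {c : ℕ} {r : List ℕ}, (c :: r).Sublist (i :: l) → r.Sublist l := by
    intro c r h
    rcases List.cons_sublist_cons'.1 h with h | ⟨-, h⟩
    · exact (List.sublist_cons_self _ _).trans h
    · exact h
  rcases alternation_sublist_append h with h | ⟨h, h'⟩ | ⟨h, h'⟩ | h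
  · exact hm a b hab h
  · rcases List.mem_cons.1 h with rfl | hal
    · have h₂ : [b, a, b].Sublist m := by
        rcases List.cons_sublist_cons'.1 h' with h | ⟨e, -⟩
        · exact h
        · exact absurd e.symm hab
      exact hm a b hab (h₂.cons_cons a)
    · have ha : a ∈ i :: m := h'.subset (by simp)
      rcases List.mem_cons.1 ha with rfl | ha
      · exact hi hal
      · exact hd hal ha
  · exact key ((second h).subset (by simp)) h'
  · rcases List.cons_sublist_cons'.1 h with h₁ | ⟨rfl, h₁⟩
    · exact hl a b hab h₁
    · exact hi (h₁.subset (by simp))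

lemma le_count_toWord {κ : ℕ → ℕ} {T : OTree} (hT : Valid κ T) {j : ℕ} (hj : j ∈ toWord T) :
    κ j + 1 ≤ (toWord T).count j := by
  have h := List.count_pos_iff.2 hj
  rw [count_toWord j T hT] at h ⊢
  exact Nat.le_mul_of_pos_right _ (Nat.pos_of_mul_pos_left h)

/-- Two parts of a word have disjoint letters if each letter of the first is exhausted there. -/
lemma notMem_of_le_count {κ : ℕ → ℕ} {l m : List ℕ} {j : ℕ} (h : (l ++ m).count j ≤ κ j + 1)
    (hl : κ j + 1 ≤ l.count j) : j ∉ m := by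
  intro hm
  have := List.count_pos_iff.2 hm
  rw [List.count_append] at h
  omega

lemma avoidsAlternation_cons_blockTail {κ : ℕ → ℕ} (i : ℕ) (es : List OTree)
    (hv : ∀ e ∈ es, Valid κ e) (ha : ∀ e ∈ es, AvoidsAlternation (toWord e))
    (hc : ∀ j, (i :: blockTail i es).count j ≤ κ j + 1) :
    AvoidsAlternation (i :: blockTail i es) := by
  induction es with
  | nil =>
    intro a b _ h
    simpa [blockTail] using h.length_le
  | cons e es ih =>
    rw [List.forall_mem_cons] at hv ha
    have hc' : ∀ j, (i :: toWord e ++ i :: blockTail i es).count j ≤ κ j + 1 := by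
      simpa [blockTail_cons] using hc
    have hd : ∀ j ∈ toWord e, j ∉ i :: blockTail i es := fun j hj =>
      notMem_of_le_count (hc' j) ((le_count_toWord hv.1 hj).trans
        (List.Sublist.count_le _ (List.sublist_cons_self _ _)))
    rw [blockTail_cons, ← List.cons_append]
    refine AvoidsAlternation.cons_append_cons ha.1 (ih hv.2 ha.2 fun j => ?_)
      (fun h => hd i h (by simp)) (fun j h₁ h₂ => hd j h₁ (by simp [h₂]))
    exact (List.Sublist.count_le _ (List.sublist_append_right _ _)).trans (hc' j)

lemma avoidsAlternation_toWord {κ : ℕ → ℕ} (T : OTree) (hT : Valid κ T)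
    (hc : ∀ j, (toWord T).count j ≤ κ j + 1) : AvoidsAlternation (toWord T) := by
  induction T using induction_grandchildren with
  | h v ts ih =>
    induction ts with
    | nil =>
      intro a b _ h
      simpa [toWord_node_nil] using h.length_le
    | cons t ts iht =>
      rw [valid_node, List.forall_mem_cons] at hT
      rw [List.forall_mem_cons] at ih
      rw [toWord_node_cons] at hc ⊢
      have hcr : ∀ j, (toWord (node v ts)).count j ≤ κ j + 1 := fun j =>
        (List.Sublist.count_le _ (List.sublist_append_right _ _)).trans (hc j)
      have hcl : ∀ j, (t.label :: blockTail t.label t.children).count j ≤ κ j + 1 := fun j =>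
        (List.Sublist.count_le _ (List.sublist_append_left _ _)).trans (hc j)
      refine AvoidsAlternation.append ?_ (iht ih.2 (valid_node.2 hT.2) hcr) ?_
      · refine avoidsAlternation_cons_blockTail _ _ hT.1.2 (fun e he => ?_) hcl
        refine ih.1 e he (hT.1.2 e he) fun j => le_trans ?_ (hcl j)
        refine List.Sublist.count_le _ (List.Sublist.cons _ ?_)
        obtain ⟨es₁, es₂, h⟩ := List.append_of_mem he
        rw [h, blockTail, List.flatMap_append, List.flatMap_cons, List.append_assoc]
        exact (List.sublist_append_left _ _).trans (List.sublist_append_right _ _)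
      · intro j h₁ h₂
        refine notMem_of_le_count (l := toWord (node v ts))
          (m := t.label :: blockTail t.label t.children) (j := j) (κ := κ) ?_
          (le_count_toWord (valid_node.2 hT.2) h₂) h₁
        rw [List.count_append, add_comm, ← List.count_append]
        exact hc j

lemma blockTail_append_inj {κ : ℕ → ℕ} {i : ℕ} {es es' : List OTree} {l l' : List ℕ}
    (hlen : es.length = es'.length)
    (hv : ∀ e ∈ es, Valid κ e) (hv' : ∀ e ∈ es', Valid κ e)
    (hc : ∀ j, (i :: (blockTail i es ++ l)).count j ≤ κ j + 1)
    (hinj : ∀ e ∈ es, ∀ e' ∈ es', (∀ j, (toWord e).count j ≤ κ j + 1) →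
      toWord e = toWord e' → e = e')
    (h : blockTail i es ++ l = blockTail i es' ++ l') : es = es' ∧ l = l' := by
  induction es generalizing es' with
  | nil =>
    obtain rfl := List.length_eq_zero_iff.1 hlen.symm
    exact ⟨rfl, by simpa [blockTail] using h⟩
  | cons e es ih =>
    cases es' with
    | nil => simp at hlen
    | cons e' es' =>
      rw [List.forall_mem_cons] at hv hv'
      have hmem : ∀ {e : OTree} {m : List ℕ}, Valid κ e →
          (∀ j, (i :: (toWord e ++ i :: m)).count j ≤ κ j + 1) → i ∉ toWord e := by
        intro e m hv hc hi
        have h₁ := le_count_toWord hv hi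
        have h₂ := hc i
        simp only [List.count_cons, List.count_append, beq_self_eq_true, if_true] at h₂
        omega
      have hc' := hc
      rw [h] at hc'
      simp only [blockTail_cons, List.append_assoc, List.cons_append] at h hc hc'
      obtain ⟨h₁, h₂⟩ := append_cons_inj_of_notMem (hmem hv.1 hc) (hmem hv'.1 hc') h
      have hce : ∀ j, (toWord e).count j ≤ κ j + 1 := fun j => le_trans
        (List.Sublist.count_le _ ((List.sublist_append_left _ _).trans
          (List.sublist_cons_self _ _))) (hc j)
      obtain rfl := hinj e (by simp) e' (by simp) hce h₁
      obtain ⟨rfl, rfl⟩ := ih (by simpa using hlen) hv.2 hv'.2 (fun j => le_trans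
        (List.Sublist.count_le _ ((List.sublist_append_right _ _).trans
          (List.sublist_cons_self _ _))) (hc j))
        (fun a ha b hb => hinj a (by simp [ha]) b (by simp [hb])) h₂
      exact ⟨rfl, rfl⟩

lemma toWord_injective {κ : ℕ → ℕ} (T T' : OTree) (hT : Valid κ T) (hT' : Valid κ T')
    (hc : ∀ j, (toWord T).count j ≤ κ j + 1) (hl : T.label = T'.label)
    (h : toWord T = toWord T') : T = T' := by
  induction T using induction_grandchildren generalizing T' with
  | h v ts ih =>
    obtain ⟨v', ts'⟩ := T'
    obtain rfl : v = v' := hl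
    congr 1
    induction ts generalizing ts' with
    | nil =>
      cases ts' with
      | nil => rfl
      | cons t ts' => simp [toWord_node_nil, toWord_node_cons] at h
    | cons t ts iht =>
      cases ts' with
      | nil => simp [toWord_node_nil, toWord_node_cons] at h
      | cons t' ts' =>
        rw [valid_node, List.forall_mem_cons] at hT hT'
        rw [List.forall_mem_cons] at ih
        rw [toWord_node_cons] at hc
        rw [toWord_node_cons, toWord_node_cons, List.cons_append, List.cons_append,
          List.cons.injEq] at h
        obtain ⟨⟨⟨hlen, hlab⟩, hv⟩, hrest⟩ := hT
        obtain ⟨⟨⟨hlen', hlab'⟩, hv'⟩, hrest'⟩ := hT'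
        obtain ⟨h₀, h⟩ := h
        rw [← h₀] at hlen' hlab' h
        obtain ⟨h₁, h₂⟩ := blockTail_append_inj (hlen.trans hlen'.symm) hv hv' hc
          (fun e he e' he' hce hw => ih.1 e he e' (hv e he) (hv' e' he') hce
            ((hlab e he).trans (hlab' e' he').symm) hw) h
        have ht : t = t' := by
          cases t
          cases t'
          simp only [label, children] at h₀ h₁
          rw [h₀, h₁]
        rw [ht, iht ih.2 (valid_node.2 hrest)
          (fun j => (List.Sublist.count_le _ (List.sublist_append_right _ _)).trans (hc j)) ts'
          (valid_node.2 hrest') h₂]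

/-- The first block of a quasi-Stirling word is the block of a tree, if all shorter words are
words of trees. -/
lemma exists_blockTail {κ : ℕ → ℕ} {N : ℕ}
    (ih : ∀ π : List ℕ, π.length < N → AvoidsAlternation π →
      (∀ j ∈ π, π.count j = κ j + 1) → ∀ v, ∃ T : OTree, T.label = v ∧ Valid κ T ∧ toWord T = π)
    (i m : ℕ) (l : List ℕ) (hlen : l.length < N) (ha : AvoidsAlternation (i :: l))
    (hm : l.count i = m) (hc : ∀ j ∈ l, j ≠ i → l.count j = κ j + 1) :
    ∃ (es : List OTree) (r : List ℕ), es.length = m ∧ (∀ e ∈ es, e.label = i ∧ Valid κ e) ∧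
      l = blockTail i es ++ r ∧ ∀ j ∈ r, r.count j = κ j + 1 := by
  induction m generalizing l with
  | zero =>
    refine ⟨[], l, rfl, by simp, by simp [blockTail], fun j hj => hc j hj ?_⟩
    rintro rfl
    exact List.count_eq_zero.1 hm hj
  | succ m ihm =>
    have hi : i ∈ l := List.count_pos_iff.1 (by omega)
    obtain ⟨s, r, rfl, his⟩ := List.eq_append_cons_of_mem hi
    have hd : ∀ j ∈ s, j ∉ r := by
      intro j hs hr
      refine ha i j (fun e => his (e ▸ hs)) ?_
      refine List.Sublist.cons_cons i ?_
      exact List.Sublist.append (l₁ := [j]) (List.singleton_sublist.2 hs)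
        ((List.singleton_sublist.2 hr).cons_cons i)
    simp only [List.length_append, List.length_cons] at hlen
    obtain ⟨e, he₁, he₂, he₃⟩ := ih s (by omega)
      (ha.of_sublist ((List.sublist_append_left _ _).trans (List.sublist_cons_self _ _)))
      (fun j hj => by
        have hji : j ≠ i := fun e => his (e ▸ hj)
        rw [← hc j (by simp [hj]) hji, List.count_append, List.count_cons_of_ne hji.symm,
          List.count_eq_zero.2 (hd j hj), add_zero]) i
    obtain ⟨es, r', h₁, h₂, h₃, h₄⟩ := ihm r (by omega)
      (ha.of_sublist ((List.sublist_append_right _ _).trans (List.sublist_cons_self _ _)))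
      (by
        rw [List.count_append, List.count_cons_self, List.count_eq_zero.2 his] at hm
        omega)
      (fun j hj hji => by
        rw [← hc j (by simp [hj]) hji, List.count_append, List.count_cons_of_ne hji.symm,
          List.count_eq_zero.2 (fun hs => hd j hs hj), zero_add])
    refine ⟨e :: es, r', by simp [h₁], List.forall_mem_cons.2 ⟨⟨he₁, he₂⟩, h₂⟩, ?_, h₄⟩
    rw [blockTail_cons, he₃, h₃]
    simp

lemma exists_toWord_eq {κ : ℕ → ℕ} (N : ℕ) : ∀ π : List ℕ, π.length < N → AvoidsAlternation π →
    (∀ j ∈ π, π.count j = κ j + 1) → ∀ v, ∃ T : OTree, T.label = v ∧ Valid κ T ∧ toWord T = π := by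
  induction N with
  | zero => simp
  | succ N ih =>
    intro π hlen ha hc v
    cases π with
    | nil => exact ⟨node v [], rfl, valid_node.2 (by simp), toWord_node_nil v⟩
    | cons i l =>
      obtain ⟨es, r, h₁, h₂, rfl, h₄⟩ := exists_blockTail ih i (κ i) l (by simpa using hlen) ha
        (by simpa using hc i (by simp))
        (fun j hj hji => by
          rw [← hc j (by simp [hj]), List.count_cons_of_ne hji.symm])
      simp only [List.length_cons, List.length_append] at hlen
      obtain ⟨⟨v', ts⟩, hl, hv, hw⟩ := ih r (by omega)
        (ha.of_sublist ((List.sublist_append_right _ _).trans (List.sublist_cons_self _ _))) h₄ v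
      obtain rfl : v' = v := hl
      refine ⟨node v' (node i es :: ts), rfl, valid_node.2 (List.forall_mem_cons.2
        ⟨⟨⟨h₁, fun e he => (h₂ e he).1⟩, fun e he => (h₂ e he).2⟩, valid_node.1 hv⟩), ?_⟩
      rw [toWord_node_cons, hw]
      rfl

lemma mem_quasiStirlingPerms {M : Multiset ℕ} {π : List ℕ} :
    π ∈ quasiStirlingPerms M ↔ (π : Multiset ℕ) = M ∧ AvoidsAlternation π := by
  rw [quasiStirlingPerms, Finset.mem_filter, isQuasiStirling_iff]
  exact and_congr_left fun _ => mem_arrangements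

lemma count_eq_oddDegree_add_one {M : Multiset ℕ} {j : ℕ} (hj : j ∈ M) :
    M.count j = oddDegree M j + 1 := by
  have := Multiset.count_pos.2 hj
  unfold oddDegree
  omega

/-- The trees of `𝒯_M` correspond to the quasi-Stirling permutations of `M`. -/
theorem bijOn_toWord (M : Multiset ℕ) :
    Set.BijOn toWord (trees M) (quasiStirlingPerms M : Set (List ℕ)) := by
  have hcount : ∀ T ∈ trees M, ∀ j, (toWord T).count j ≤ oddDegree M j + 1 := by
    intro T hT j
    rw [← Multiset.coe_count, (mem_trees_iff.1 hT).2.2, oddDegree]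
    omega
  refine ⟨fun T hT => ?_, fun T hT T' hT' h => ?_, fun π hπ => ?_⟩
  · have h := mem_trees_iff.1 hT
    exact mem_quasiStirlingPerms.2 ⟨h.2.2, avoidsAlternation_toWord T h.2.1 (hcount T hT)⟩
  · have h₁ := mem_trees_iff.1 hT
    have h₂ := mem_trees_iff.1 hT'
    exact toWord_injective T T' h₁.2.1 h₂.2.1 (hcount T hT) (h₁.1.trans h₂.1.symm) h
  · obtain ⟨rfl, ha⟩ := mem_quasiStirlingPerms.1 hπ
    obtain ⟨T, h₁, h₂, h₃⟩ := exists_toWord_eq (κ := oddDegree π) _ π (Nat.lt_succ_self _) ha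
      (fun j hj => by
        rw [← Multiset.coe_count]
        exact count_eq_oddDegree_add_one (by simpa using hj)) 0
    exact ⟨T, mem_trees_iff.2 ⟨h₁, h₂, by rw [h₃]⟩, h₃⟩

lemma trees_finite (M : Multiset ℕ) : (trees M).Finite :=
  (bijOn_toWord M).finite_iff_finite.2 (Finset.finite_toSet _)

/-! ### The weight of a tree -/

@[to_additive]
lemma prod_map_flatMap {α β R : Type*} [CommMonoid R] (l : List α) (f : α → List β) (g : β → R) :
    ((l.flatMap f).map g).prod = (l.map fun a => ((f a).map g).prod).prod := by
  induction l with
  | nil => rfl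
  | cons a l ih => simp [ih]

lemma pairProd_blockTail_append {R : Type*} [CommMonoid R] (g : ℕ → ℕ → R) (i : ℕ)
    (es : List OTree) (l : List ℕ) (q : ℕ) :
    pairProd g i (blockTail i es ++ l) q =
      (es.map fun e => pairProd g i (toWord e) i).prod * pairProd g i l q := by
  induction es with
  | nil => simp [blockTail]
  | cons e es ih =>
    rw [blockTail_cons, List.append_assoc, List.cons_append, pairProd_append_cons, ih,
      List.map_cons, List.prod_cons, mul_assoc]

/-- The product over the pairs of adjacent letters of the word of a tree is the product over the
even vertices of the tree of the same products for their own words. -/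
lemma pairProd_toWord {R : Type*} [CommMonoid R] (g : ℕ → ℕ → R) {κ : ℕ → ℕ} (T : OTree)
    (hT : Valid κ T) : pairProd g T.label (toWord T) T.label =
      (T.evens.map fun e => pairProd g e.label (e.children.map label) e.label).prod := by
  induction T using induction_grandchildren with
  | h v ts ih =>
    rw [valid_node] at hT
    rw [evens_node, List.map_cons, List.prod_cons]
    simp only [label, children]
    suffices h : ∀ p, pairProd g p (toWord (node v ts)) v = pairProd g p (ts.map label) v *
        ((ts.flatMap fun t => t.children.flatMap evens).map fun e =>
          pairProd g e.label (e.children.map label) e.label).prod from h v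
    induction ts with
    | nil => simp [toWord_node_nil]
    | cons t ts iht =>
      intro p
      rw [List.forall_mem_cons] at hT ih
      obtain ⟨⟨⟨-, hlab⟩, hv⟩, hrest⟩ := hT
      have he : (t.children.map fun e => pairProd g t.label (toWord e) t.label).prod =
          ((t.children.flatMap evens).map fun e =>
            pairProd g e.label (e.children.map label) e.label).prod := by
        rw [prod_map_flatMap]
        congr 1
        refine List.map_congr_left fun e he => ?_
        rw [← hlab e he]
        exact ih.1 e he (hv e he)
      rw [toWord_node_cons, List.cons_append, pairProd, pairProd_blockTail_append,
        iht ih.2 hrest, List.map_cons, pairProd, List.flatMap_cons, List.map_append,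
        List.prod_append, he]
      ac_rfl

namespace OTree

/-! ### The words of the even vertices as a function of a key -/

/-- The list of the words of the even vertices of a tree. Each word is recorded by its tail, the
list of the labels of the children, together with a key of the vertex: its label and its position
among its siblings, which is `r` for the root. -/
def keyedWords : ℕ → OTree → List ((ℕ × ℕ) × List ℕ)
  | r, node v ts => ((v, r), ts.map label) :: ts.attach.flatMap fun t =>
      t.1.children.attach.zipIdx.flatMap fun p => keyedWords p.2 p.1.1
termination_by _ t => sizeOf t
decreasing_by
  have h := List.sizeOf_lt_of_mem t.2
  have h' := sizeOf_lt_of_mem_children p.1.2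
  simp only [node.sizeOf_spec]
  omega

/-- The keyed words of the trees of a list, whose roots are siblings with positions from `n` on. -/
def siblingsKeyedWords (n : ℕ) (es : List OTree) : List ((ℕ × ℕ) × List ℕ) :=
  (es.zipIdx n).flatMap fun p => keyedWords p.2 p.1

lemma keyedWords_node (r v : ℕ) (ts : List OTree) : keyedWords r (node v ts) =
    ((v, r), ts.map label) :: ts.flatMap fun t => siblingsKeyedWords 0 t.children := by
  have h : ∀ es : List OTree, (es.attach.zipIdx.flatMap fun p => keyedWords p.2 p.1.1) =
      siblingsKeyedWords 0 es := by
    intro es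
    conv_rhs => rw [siblingsKeyedWords, ← List.attach_map_subtype_val es, List.zipIdx_map,
      List.flatMap_map]
    rfl
  rw [keyedWords]
  simp only [h]
  rw [flatMap_attach ts fun t => siblingsKeyedWords 0 t.children]

lemma siblingsKeyedWords_nil (n : ℕ) : siblingsKeyedWords n [] = [] := rfl

lemma siblingsKeyedWords_cons (n : ℕ) (e : OTree) (es : List OTree) :
    siblingsKeyedWords n (e :: es) = keyedWords n e ++ siblingsKeyedWords (n + 1) es := by
  simp [siblingsKeyedWords, List.zipIdx_cons]

/-- The keys of the children of a vertex at odd level labeled `i`. -/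
def childKeys (κ : ℕ → ℕ) (i : ℕ) : List (ℕ × ℕ) := (List.range' 0 (κ i)).map (Prod.mk i)

lemma map_fst_siblingsKeyedWords {κ : ℕ → ℕ} {i : ℕ} (es : List OTree) (n : ℕ)
    (hl : ∀ e ∈ es, e.label = i)
    (h : ∀ e ∈ es, ∀ r, ((keyedWords r e).map Prod.fst).Perm
      ((e.label, r) :: (e.odds.map label).flatMap (childKeys κ))) :
    ((siblingsKeyedWords n es).map Prod.fst).Perm ((List.range' n es.length).map (Prod.mk i) ++
      ((es.flatMap odds).map label).flatMap (childKeys κ)) := by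
  induction es generalizing n with
  | nil => simp [siblingsKeyedWords_nil]
  | cons e es ih =>
    rw [List.forall_mem_cons] at hl h
    have h₁ := ih (n + 1) hl.2 h.2
    have h₂ := h.1 n
    rw [hl.1] at h₂
    rw [siblingsKeyedWords_cons, List.map_append]
    refine (h₂.append h₁).trans (List.perm_iff_count.2 fun a => ?_)
    simp only [List.length_cons, List.range'_succ, List.map_cons, List.cons_append,
      List.count_cons, List.count_append, List.flatMap_cons, List.map_append, List.flatMap_append]
    omega

lemma map_fst_keyedWords {κ : ℕ → ℕ} (T : OTree) (hT : Valid κ T) (r : ℕ) :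
    ((keyedWords r T).map Prod.fst).Perm
      ((T.label, r) :: (T.odds.map label).flatMap (childKeys κ)) := by
  induction T using induction_grandchildren generalizing r with
  | h v ts ih =>
    rw [valid_node] at hT
    rw [keyedWords_node, List.map_cons, odds_node, List.map_flatMap, List.map_flatMap,
      List.flatMap_assoc]
    refine List.Perm.cons _ (List.Perm.flatMap_left _ fun t ht => ?_)
    obtain ⟨⟨hlen, hlab⟩, hv⟩ := hT t ht
    have := map_fst_siblingsKeyedWords (κ := κ) t.children 0 hlab
      fun e he => ih t ht e he (hv e he)
    rw [hlen] at this
    simpa [childKeys] using this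

lemma map_word_keyedWords (T : OTree) (r : ℕ) :
    (keyedWords r T).map (fun p => (p.1.1, p.2)) =
      T.evens.map fun e => (e.label, e.children.map label) := by
  induction T using induction_grandchildren generalizing r with
  | h v ts ih =>
    rw [keyedWords_node, evens_node, List.map_cons, List.map_cons, List.map_flatMap,
      List.map_flatMap]
    congr 1
    refine List.flatMap_congr fun t ht => ?_
    have : ∀ (es : List OTree) (n : ℕ), (∀ e ∈ es, e ∈ t.children) →
        (siblingsKeyedWords n es).map (fun p => (p.1.1, p.2)) =
          (es.flatMap evens).map fun e => (e.label, e.children.map label) := by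
      intro es
      induction es with
      | nil => intros; rfl
      | cons e es ihe =>
        intro n hes
        rw [List.forall_mem_cons] at hes
        rw [siblingsKeyedWords_cons, List.map_append, ih t ht e hes.1, ihe _ hes.2,
          List.flatMap_cons, List.map_append]
    exact this _ _ fun _ h => h

/-- A tree is determined by the function that maps the keys of its even vertices to their words. -/
lemma eq_of_keyedWords {κ : ℕ → ℕ} {L : ℕ × ℕ → List ℕ} (T T' : OTree) (r : ℕ) (hT : Valid κ T)
    (hT' : Valid κ T') (hl : T.label = T'.label) (h : ∀ p ∈ keyedWords r T, L p.1 = p.2)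
    (h' : ∀ p ∈ keyedWords r T', L p.1 = p.2) : T = T' := by
  induction T using induction_grandchildren generalizing T' r with
  | h v ts ih =>
    obtain ⟨v', ts'⟩ := T'
    obtain rfl : v = v' := hl
    rw [keyedWords_node, List.forall_mem_cons] at h h'
    rw [valid_node] at hT hT'
    have hlab : ts.map label = ts'.map label := h.1.symm.trans h'.1
    replace h := h.2
    replace h' := h'.2
    congr 1
    induction ts generalizing ts' with
    | nil => exact (List.map_eq_nil_iff.1 hlab.symm).symm
    | cons t ts iht =>
      cases ts' with
      | nil => simp at hlab
      | cons t' ts' =>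
        rw [List.forall_mem_cons] at ih hT hT'
        rw [List.flatMap_cons, List.forall_mem_append] at h h'
        rw [List.map_cons, List.map_cons, List.cons.injEq] at hlab
        have key : ∀ (es es' : List OTree) (n : ℕ), (∀ e ∈ es, e ∈ t.children) →
            (∀ e ∈ es', e ∈ t'.children) → es.length = es'.length →
            (∀ p ∈ siblingsKeyedWords n es, L p.1 = p.2) →
            (∀ p ∈ siblingsKeyedWords n es', L p.1 = p.2) → es = es' := by
          intro es
          induction es with
          | nil =>
            intro es' n _ _ hlen _ _
            exact (List.length_eq_zero_iff.1 hlen.symm).symm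
          | cons e es ihe =>
            intro es' n hes hes' hlen hL hL'
            cases es' with
            | nil => simp at hlen
            | cons e' es' =>
              rw [List.forall_mem_cons] at hes hes'
              rw [siblingsKeyedWords_cons, List.forall_mem_append] at hL hL'
              rw [ih.1 e hes.1 e' n (hT.1.2 e hes.1) (hT'.1.2 e' hes'.1)
                ((hT.1.1.2 e hes.1).trans (hlab.1.trans (hT'.1.1.2 e' hes'.1).symm)) hL.1 hL'.1,
                ihe es' (n + 1) hes.2 hes'.2 (by simpa using hlen) hL.2 hL'.2]
        have hc : t.children = t'.children := key _ _ 0 (fun _ h => h) (fun _ h => h)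
          (by rw [hT.1.1.1, hT'.1.1.1, hlab.1]) h.1 h'.1
        have ht : t = t' := by
          cases t
          cases t'
          simp only [label, children] at hlab hc
          rw [hlab.1, hc]
        rw [ht, iht ih.2 hT.2 ts' hT'.2 hlab.2 h.2 h'.2]

lemma exists_perm_map_eq {α : Type*} (f : α → ℕ) (l : List ℕ) :
    ∀ ts : List α, l.Perm (ts.map f) → ∃ ts' : List α, ts'.Perm ts ∧ ts'.map f = l := by
  induction l with
  | nil =>
    intro ts h
    exact ⟨[], by simpa using h, rfl⟩
  | cons a l ih =>
    intro ts h
    obtain ⟨t, ht, rfl⟩ := List.mem_map.1 (h.subset (List.mem_cons_self))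
    obtain ⟨s₁, s₂, rfl⟩ := List.append_of_mem ht
    have hp : (s₁ ++ t :: s₂).Perm (t :: (s₁ ++ s₂)) := List.perm_middle
    obtain ⟨ts', h₁, h₂⟩ := ih (s₁ ++ s₂) ((h.trans (hp.map f)).cons_inv)
    exact ⟨t :: ts', (h₁.cons t).trans hp.symm, by rw [List.map_cons, h₂]⟩

lemma exists_siblings_rearrangement {κ : ℕ → ℕ} {L : ℕ × ℕ → List ℕ} {i : ℕ} (es : List OTree)
    (n : ℕ)
    (ih : ∀ e ∈ es, ∀ r, (∀ p ∈ keyedWords r e, (L p.1).Perm p.2) → ∃ e' : OTree,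
      e'.label = e.label ∧ Valid κ e' ∧ (∀ p ∈ keyedWords r e', L p.1 = p.2) ∧
        (e'.odds.map label).Perm (e.odds.map label))
    (hl : ∀ e ∈ es, e.label = i) (h : ∀ p ∈ siblingsKeyedWords n es, (L p.1).Perm p.2) :
    ∃ es' : List OTree, es'.length = es.length ∧ (∀ e ∈ es', e.label = i) ∧
      (∀ e ∈ es', Valid κ e) ∧ (∀ p ∈ siblingsKeyedWords n es', L p.1 = p.2) ∧
      ((es'.flatMap odds).map label).Perm ((es.flatMap odds).map label) := by
  induction es generalizing n with
  | nil => exact ⟨[], rfl, by simp, by simp, by simp [siblingsKeyedWords_nil], by simp⟩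
  | cons e es ihe =>
    rw [List.forall_mem_cons] at ih hl
    rw [siblingsKeyedWords_cons, List.forall_mem_append] at h
    obtain ⟨e', a₁, a₂, a₃, a₄⟩ := ih.1 n h.1
    obtain ⟨es', b₁, b₂, b₃, b₄, b₅⟩ := ihe (n + 1) ih.2 hl.2 h.2
    refine ⟨e' :: es', by simp [b₁], List.forall_mem_cons.2 ⟨a₁.trans hl.1, b₂⟩,
      List.forall_mem_cons.2 ⟨a₂, b₃⟩, ?_, ?_⟩
    · rw [siblingsKeyedWords_cons, List.forall_mem_append]
      exact ⟨a₃, b₄⟩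
    · rw [List.flatMap_cons, List.flatMap_cons, List.map_append, List.map_append]
      exact a₄.append b₅

/-- The words of the even vertices of a tree can be rearranged at will. -/
lemma exists_rearrangement {κ : ℕ → ℕ} {L : ℕ × ℕ → List ℕ} (T : OTree) (r : ℕ) (hT : Valid κ T)
    (h : ∀ p ∈ keyedWords r T, (L p.1).Perm p.2) : ∃ T' : OTree,
      T'.label = T.label ∧ Valid κ T' ∧ (∀ p ∈ keyedWords r T', L p.1 = p.2) ∧
        (T'.odds.map label).Perm (T.odds.map label) := by
  induction T using induction_grandchildren generalizing r with
  | h v ts ih =>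
    rw [keyedWords_node, List.forall_mem_cons] at h
    rw [valid_node] at hT
    have key : ∃ ts' : List OTree, ts'.map label = ts.map label ∧
        (∀ t ∈ ts', (t.children.length = κ t.label ∧
          ∀ c ∈ t.children, c.label = t.label) ∧ ∀ e ∈ t.children, Valid κ e) ∧
        (∀ t ∈ ts', ∀ p ∈ siblingsKeyedWords 0 t.children, L p.1 = p.2) ∧
        ((ts'.flatMap fun t => t :: t.children.flatMap odds).map label).Perm
          ((ts.flatMap fun t => t :: t.children.flatMap odds).map label) := by
      have h := h.2
      clear * - ih hT h
      induction ts with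
      | nil => exact ⟨[], rfl, by simp, by simp, by simp⟩
      | cons t ts iht =>
        rw [List.forall_mem_cons] at ih hT
        rw [List.flatMap_cons, List.forall_mem_append] at h
        obtain ⟨es', a₁, a₂, a₃, a₄, a₅⟩ := exists_siblings_rearrangement (κ := κ) t.children 0
          (fun e he r hr => ih.1 e he r (hT.1.2 e he) hr) hT.1.1.2 h.1
        obtain ⟨ts', b₁, b₂, b₃, b₄⟩ := iht ih.2 hT.2 h.2
        refine ⟨node t.label es' :: ts', ?_, List.forall_mem_cons.2
          ⟨⟨⟨a₁.trans hT.1.1.1, a₂⟩, a₃⟩, b₂⟩, List.forall_mem_cons.2 ⟨a₄, b₃⟩, ?_⟩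
        · rw [List.map_cons, List.map_cons, b₁]
          rfl
        · rw [List.flatMap_cons, List.flatMap_cons, List.map_append, List.map_append,
            List.map_cons, List.map_cons]
          exact (a₅.cons _).append b₄
    obtain ⟨ts', h₁, h₂, h₃, h₄⟩ := key
    obtain ⟨ts'', hp, hm⟩ := exists_perm_map_eq label (L (v, r)) ts' (by rw [h₁]; exact h.1)
    refine ⟨node v ts'', rfl, valid_node.2 fun t ht => h₂ t (hp.subset ht), ?_, ?_⟩
    · rw [keyedWords_node, List.forall_mem_cons]
      refine ⟨hm.symm, fun p hpm => ?_⟩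
      obtain ⟨t, ht, hpt⟩ := List.mem_flatMap.1 hpm
      exact h₃ t (hp.subset ht) p hpt
    · rw [odds_node, odds_node]
      exact ((hp.flatMap_right _).map _).trans h₄

/-- If the odd vertices have distinct labels, different from the label of the root, then the
entries of each word of an even vertex are distinct. -/
lemma nodup_word_of_nodup_odds {κ : ℕ → ℕ} (T : OTree) (hT : Valid κ T)
    (h : (T.label :: T.odds.map label).Nodup) :
    ∀ e ∈ T.evens, (e.label :: e.children.map label).Nodup := by
  induction T using induction_grandchildren with
  | h v ts ih =>
    rw [valid_node] at hT
    rw [evens_node, List.forall_mem_cons]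
    rw [odds_node] at h
    constructor
    · refine h.sublist (List.Sublist.cons_cons _ (List.Sublist.map _ ?_))
      simp only [children]
      clear h ih hT
      induction ts with
      | nil => simp
      | cons t ts iht =>
        rw [List.flatMap_cons, List.cons_append]
        exact List.Sublist.cons_cons _ (iht.trans (List.sublist_append_right _ _))
    · intro u hu
      obtain ⟨t, ht, hu⟩ := List.mem_flatMap.1 hu
      obtain ⟨e, he, hu⟩ := List.mem_flatMap.1 hu
      refine ih t ht e he ((hT t ht).2 e he) ?_ u hu
      rw [(hT t ht).1.2 e he]
      refine (List.nodup_cons.1 h).2.sublist ?_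
      rw [← List.map_cons]
      refine List.Sublist.map _ ?_
      obtain ⟨ts₁, ts₂, rfl⟩ := List.append_of_mem ht
      obtain ⟨es₁, es₂, hes⟩ := List.append_of_mem he
      rw [List.flatMap_append, List.flatMap_cons, hes, List.flatMap_append, List.flatMap_cons]
      refine List.Sublist.trans ?_ (List.sublist_append_right _ _)
      refine List.Sublist.trans (List.Sublist.cons_cons _ ?_) (List.sublist_append_left _ _)
      exact (List.sublist_append_left _ _).trans (List.sublist_append_right _ _)

end OTree

/-! ### Sums over trees of products over the even vertices -/

/-- A sum of products over a set of families of words that is closed under rearranging the words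
can be evaluated by summing over the arrangements of each word separately. -/
lemma sum_prod_eq_of_arrangements {U R : Type*} [Fintype U] [DecidableEq U] [CommRing R]
    (A : Finset (U → List ℕ)) (hA : ∀ L ∈ A, ∀ L' : U → List ℕ, (∀ u, (L' u).Perm (L u)) → L' ∈ A)
    (w w' : U → List ℕ → R)
    (h : ∀ L ∈ A, ∀ u, ∑ l ∈ arrangements (L u), w u l = ∑ l ∈ arrangements (L u), w' u l) :
    ∑ L ∈ A, ∏ u, w u (L u) = ∑ L ∈ A, ∏ u, w' u (L u) := by
  classical
  set g : (U → List ℕ) → U → Multiset ℕ := fun L u => (L u : Multiset ℕ) with hg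
  have hmaps : ∀ L ∈ A, g L ∈ A.image g := fun L hL => Finset.mem_image_of_mem g hL
  rw [← Finset.sum_fiberwise_of_maps_to hmaps, ← Finset.sum_fiberwise_of_maps_to hmaps]
  refine Finset.sum_congr rfl fun j hj => ?_
  obtain ⟨L, hL, rfl⟩ := Finset.mem_image.1 hj
  have hfib : A.filter (fun L' => g L' = g L) =
      Fintype.piFinset fun u => arrangements (L u) := by
    ext L'
    simp only [Finset.mem_filter, Fintype.mem_piFinset, mem_arrangements, hg, funext_iff]
    exact ⟨fun h => h.2, fun h => ⟨hA L hL L' fun u => Multiset.coe_eq_coe.1 (h u), h⟩⟩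
  rw [hfib, ← Finset.prod_univ_sum, ← Finset.prod_univ_sum]
  exact Finset.prod_congr rfl fun u _ => h L hL u

/-- The keys of the even vertices of the trees of `𝒯_M`. -/
def treeKeys (M : Multiset ℕ) : Multiset (ℕ × ℕ) :=
  (0, 0) ::ₘ M.dedup.bind fun i => (childKeys (oddDegree M) i : Multiset (ℕ × ℕ))

lemma nodup_treeKeys {M : Multiset ℕ} (h0 : 0 ∉ M) : (treeKeys M).Nodup := by
  rw [treeKeys, Multiset.nodup_cons, Multiset.nodup_bind]
  refine ⟨?_, ?_, ?_⟩
  · simp only [Multiset.mem_bind, Multiset.mem_dedup, childKeys, Multiset.mem_coe, List.mem_map,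
      not_exists, not_and]
    rintro i hi s _ h
    obtain ⟨rfl, -⟩ := Prod.mk.inj h
    exact h0 hi
  · intro i _
    rw [Multiset.coe_nodup, childKeys]
    exact (List.nodup_range' (s := 0) (n := oddDegree M i)).map (Prod.mk_right_injective i)
  · refine (Multiset.nodup_dedup M).pairwise fun i _ j _ hij => ?_
    rw [Function.onFun, Multiset.disjoint_left]
    simp only [childKeys, Multiset.mem_coe, List.mem_map, not_exists, not_and]
    rintro _ ⟨s, _, rfl⟩ s' _ h
    exact hij (Prod.mk.inj h).1.symm

lemma coe_map_fst_keyedWords {M : Multiset ℕ} {T : OTree} (hT : T ∈ trees M) :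
    (((keyedWords 0 T).map Prod.fst : List (ℕ × ℕ)) : Multiset (ℕ × ℕ)) = treeKeys M := by
  have h := mem_trees_iff.1 hT
  rw [Multiset.coe_eq_coe.2 (map_fst_keyedWords T h.2.1 0), h.1, treeKeys,
    ← coe_odds_of_mem_trees hT, Multiset.coe_bind, Multiset.cons_coe]

/-- The tail of the word of the even vertex with a given key. -/
def wordAt (T : OTree) (u : ℕ × ℕ) : List ℕ := ((keyedWords 0 T).lookup u).getD []

lemma lookup_eq_some_of_nodup {α β : Type*} [BEq α] [LawfulBEq α] {l : List (α × β)}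
    (h : (l.map Prod.fst).Nodup) {p : α × β} (hp : p ∈ l) : l.lookup p.1 = some p.2 := by
  induction l with
  | nil => simp at hp
  | cons q l ih =>
    rw [List.map_cons, List.nodup_cons] at h
    obtain ⟨a, b⟩ := q
    rcases List.mem_cons.1 hp with rfl | hpl
    · simp
    · have hne : (p.1 == a) = false := by
        rw [beq_eq_false_iff_ne]
        rintro rfl
        exact h.1 (List.mem_map.2 ⟨p, hpl, rfl⟩)
      rw [List.lookup_cons, hne]
      exact ih h.2 hpl

lemma wordAt_of_mem {M : Multiset ℕ} (h0 : 0 ∉ M) {T : OTree} (hT : T ∈ trees M)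
    {p : (ℕ × ℕ) × List ℕ} (hp : p ∈ keyedWords 0 T) : wordAt T p.1 = p.2 := by
  have h : ((keyedWords 0 T).map Prod.fst).Nodup := by
    rw [← Multiset.coe_nodup, coe_map_fst_keyedWords hT]
    exact nodup_treeKeys h0
  rw [wordAt, lookup_eq_some_of_nodup h hp, Option.getD_some]

lemma prod_evens_eq {M : Multiset ℕ} (h0 : 0 ∉ M) {T : OTree} (hT : T ∈ trees M) {R : Type*}
    [CommMonoid R] (f : ℕ → List ℕ → R) :
    (T.evens.map fun e => f e.label (e.children.map label)).prod =
      ∏ u : (treeKeys M).toFinset, f u.1.1 (wordAt T u.1) := by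
  have h₁ : (T.evens.map fun e => f e.label (e.children.map label)) =
      ((keyedWords 0 T).map Prod.fst).map fun u => f u.1 (wordAt T u) := by
    have := congrArg (List.map fun q : ℕ × List ℕ => f q.1 q.2) (map_word_keyedWords T 0)
    rw [List.map_map, List.map_map] at this
    refine Eq.trans this.symm ?_
    rw [List.map_map]
    refine List.map_congr_left fun p hp => ?_
    simp only [Function.comp, wordAt_of_mem h0 hT hp]
  rw [h₁, Finset.prod_coe_sort (treeKeys M).toFinset fun u => f u.1 (wordAt T u),
    Finset.prod_eq_multiset_prod, Multiset.toFinset_val, (nodup_treeKeys h0).dedup,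
    ← coe_map_fst_keyedWords hT, Multiset.map_coe, Multiset.prod_coe]

lemma mem_keyedWords_of_mem_treeKeys {M : Multiset ℕ} (h0 : 0 ∉ M) {T : OTree} (hT : T ∈ trees M)
    {u : ℕ × ℕ} (hu : u ∈ treeKeys M) : (u, wordAt T u) ∈ keyedWords 0 T := by
  rw [← coe_map_fst_keyedWords hT, Multiset.mem_coe] at hu
  obtain ⟨p, hp, rfl⟩ := List.mem_map.1 hu
  rw [wordAt_of_mem h0 hT hp]
  exact hp

lemma mem_treeKeys_of_mem_keyedWords {M : Multiset ℕ} {T : OTree} (hT : T ∈ trees M)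
    {p : (ℕ × ℕ) × List ℕ} (hp : p ∈ keyedWords 0 T) : p.1 ∈ treeKeys M := by
  rw [← coe_map_fst_keyedWords hT, Multiset.mem_coe]
  exact List.mem_map_of_mem hp

lemma nodup_word {M : Multiset ℕ} (h0 : 0 ∉ M) {T : OTree} (hT : T ∈ trees M) :
    ∀ e ∈ T.evens, (e.label :: e.children.map label).Nodup := by
  have h := mem_trees_iff.1 hT
  refine nodup_word_of_nodup_odds T h.2.1 ?_
  rw [← Multiset.coe_nodup, ← Multiset.cons_coe, coe_odds_of_mem_trees hT, h.1,
    Multiset.nodup_cons, Multiset.mem_dedup]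
  exact ⟨h0, Multiset.nodup_dedup M⟩

lemma nodup_wordAt {M : Multiset ℕ} (h0 : 0 ∉ M) {T : OTree} (hT : T ∈ trees M) {u : ℕ × ℕ}
    (hu : u ∈ treeKeys M) : (u.1 :: wordAt T u).Nodup := by
  have h := List.mem_map_of_mem (f := fun p : (ℕ × ℕ) × List ℕ => (p.1.1, p.2))
    (mem_keyedWords_of_mem_treeKeys h0 hT hu)
  rw [map_word_keyedWords] at h
  obtain ⟨e, he, heq⟩ := List.mem_map.1 h
  obtain ⟨e₁, e₂⟩ := Prod.mk.inj heq
  have := nodup_word h0 hT e he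
  rwa [e₁, e₂] at this

lemma injOn_wordAt {M : Multiset ℕ} (h0 : 0 ∉ M) :
    Set.InjOn (fun (T : OTree) (u : (treeKeys M).toFinset) => wordAt T u.1) (trees M) := by
  intro T hT T' hT' h
  have h₁ := mem_trees_iff.1 hT
  have h₂ := mem_trees_iff.1 hT'
  refine eq_of_keyedWords (L := wordAt T) T T' 0 h₁.2.1 h₂.2.1 (h₁.1.trans h₂.1.symm)
    (fun p hp => wordAt_of_mem h0 hT hp) fun p hp => ?_
  rw [← wordAt_of_mem h0 hT' hp]
  exact congrFun h ⟨p.1, Multiset.mem_toFinset.2 (mem_treeKeys_of_mem_keyedWords hT' hp)⟩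

lemma exists_wordAt_eq {M : Multiset ℕ} (h0 : 0 ∉ M) {T : OTree} (hT : T ∈ trees M)
    (L : (treeKeys M).toFinset → List ℕ) (hL : ∀ u, (L u).Perm (wordAt T u.1)) :
    ∃ T' ∈ trees M, (fun u : (treeKeys M).toFinset => wordAt T' u.1) = L := by
  have h := mem_trees_iff.1 hT
  set L' : ℕ × ℕ → List ℕ := fun u =>
    if hu : u ∈ (treeKeys M).toFinset then L ⟨u, hu⟩ else [] with hL'
  obtain ⟨T', h₁, h₂, h₃, h₄⟩ := exists_rearrangement (L := L') T 0 h.2.1 fun p hp => by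
    have hu := Multiset.mem_toFinset.2 (mem_treeKeys_of_mem_keyedWords hT hp)
    have := hL ⟨p.1, hu⟩
    rw [wordAt_of_mem h0 hT hp] at this
    simpa only [hL', hu, dif_pos] using this
  have hT' : T' ∈ trees M := by
    refine mem_trees_iff.2 ⟨h₁.trans h.1, h₂, ?_⟩
    rw [← h.2.2]
    ext j
    rw [Multiset.coe_count, Multiset.coe_count, count_toWord j T' h₂, count_toWord j T h.2.1,
      h₄.count_eq]
  refine ⟨T', hT', funext fun u => ?_⟩
  have := h₃ _ (mem_keyedWords_of_mem_treeKeys h0 hT' (Multiset.mem_toFinset.1 u.2))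
  simpa only [hL', u.2, dif_pos] using this.symm

/-- Two weights of words with the same sum over the arrangements of each set give the same sum over
the trees of `𝒯_M` of the products over the even vertices. -/
theorem sum_trees_eq {M : Multiset ℕ} (h0 : 0 ∉ M) {R : Type*} [CommRing R] (w w' : ℕ → List ℕ → R)
    (h : ∀ (v : ℕ) (s : Multiset ℕ), s.Nodup → v ∉ s →
      ∑ l ∈ arrangements s, w v l = ∑ l ∈ arrangements s, w' v l) :
    ∑ T ∈ (trees_finite M).toFinset, (T.evens.map fun e => w e.label (e.children.map label)).prod =
      ∑ T ∈ (trees_finite M).toFinset,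
        (T.evens.map fun e => w' e.label (e.children.map label)).prod := by
  classical
  set Φ := fun (T : OTree) (u : (treeKeys M).toFinset) => wordAt T u.1 with hΦ
  have hinj : Set.InjOn Φ ((trees_finite M).toFinset : Set OTree) := by
    rw [Set.Finite.coe_toFinset]
    exact injOn_wordAt h0
  have hsum : ∀ w : ℕ → List ℕ → R, ∑ T ∈ (trees_finite M).toFinset,
      (T.evens.map fun e => w e.label (e.children.map label)).prod =
      ∑ L ∈ (trees_finite M).toFinset.image Φ, ∏ u, w u.1.1 (L u) := by
    intro w
    rw [Finset.sum_image hinj]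
    exact Finset.sum_congr rfl fun T hT => prod_evens_eq h0 ((trees_finite M).mem_toFinset.1 hT) w
  rw [hsum, hsum]
  refine sum_prod_eq_of_arrangements _ ?_ (fun u : (treeKeys M).toFinset => w u.1.1)
    (fun u => w' u.1.1) ?_
  · intro L hL L' hL'
    obtain ⟨T, hT, rfl⟩ := Finset.mem_image.1 hL
    obtain ⟨T', hT', rfl⟩ := exists_wordAt_eq h0 ((trees_finite M).mem_toFinset.1 hT) L' hL'
    exact Finset.mem_image_of_mem _ ((trees_finite M).mem_toFinset.2 hT')
  · intro L hL u
    obtain ⟨T, hT, rfl⟩ := Finset.mem_image.1 hL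
    have := nodup_wordAt h0 ((trees_finite M).mem_toFinset.1 hT) (Multiset.mem_toFinset.1 u.2)
    rw [List.nodup_cons] at this
    exact h _ _ this.2 this.1

/-! ### Statistics of trees in terms of the even vertices -/

lemma sum_map_filter_add_sum_map_filter_not {α : Type*} (l : List α) (p : α → Bool) (f : α → ℕ) :
    ((l.filter p).map f).sum + ((l.filter fun a => !p a).map f).sum = (l.map f).sum := by
  induction l with
  | nil => rfl
  | cons a l ih =>
    cases h : p a <;> simp [h] <;> omega

lemma cdes_eq_sum_evens {κ : ℕ → ℕ} {T : OTree} (hT : Valid κ T) :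
    T.cdes = (T.evens.map fun e => wordCdes e.word).sum := by
  have h : (T.odds.map fun u => wordCdes u.word).sum = 0 := by
    rw [List.sum_eq_zero_iff]
    simp only [List.mem_map]
    rintro _ ⟨u, hu, rfl⟩
    have : u.word = List.replicate (u.children.length + 1) u.label := by
      rw [List.replicate_succ, word, List.cons.injEq, List.eq_replicate_iff]
      refine ⟨rfl, by simp, fun b hb => ?_⟩
      obtain ⟨c, hc, rfl⟩ := List.mem_map.1 hb
      exact (hT u hu).2 c hc
    rw [this, wordCdes_replicate]
  rw [cdes, ← sum_map_filter_add_sum_map_filter_not _ fun v => decide (Even v.1)]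
  rw [← filter_odd_vertices, List.map_map] at h
  rw [← filter_even_vertices, List.map_map]
  exact congrArg _ h

lemma eleaf_eq_countP_evens (T : OTree) : T.eleaf = T.evens.countP fun e => e.children.isEmpty := by
  rw [eleaf, ← filter_even_vertices, List.countP_map, List.countP_filter]
  refine List.countP_congr fun v _ => ?_
  simp [and_comm]

lemma dcdes_eq_zero_iff (T : OTree) : T.dcdes = 0 ↔
    ∀ e ∈ T.evens, ∀ i < e.word.length, ¬ IsDoubleCyclicDescent e.word i := by
  rw [← filter_even_vertices, dcdes, List.sum_eq_zero_iff]
  simp only [List.mem_map, forall_exists_index, and_imp, forall_apply_eq_imp_iff₂]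
  refine forall₂_congr fun v _ => ?_
  rw [Nat.add_eq_zero_iff, Finset.card_eq_zero, Finset.filter_eq_empty_iff]
  have hlen : v.2.word.length = v.2.children.length + 1 := by simp [word]
  constructor
  · rintro ⟨h₁, h₂⟩ i hi
    rcases Nat.eq_zero_or_pos i with rfl | h
    · simpa using h₁
    · exact h₂ (Finset.mem_Icc.2 ⟨h, by omega⟩)
  · intro h
    refine ⟨by simpa using h 0 (by omega), fun i hi => h i ?_⟩
    have := Finset.mem_Icc.1 hi
    omega

lemma sum_length_word_evens (T : OTree) :
    (T.evens.map fun e => e.word.length).sum = (toWord T).length + 1 := by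
  induction T using induction_grandchildren with
  | h v ts ih =>
    rw [evens_node, List.map_cons, List.sum_cons]
    have hw : (node v ts).word.length = ts.length + 1 := by simp [word, children]
    rw [hw]
    induction ts with
    | nil => simp [toWord_node_nil]
    | cons t ts iht =>
      rw [List.forall_mem_cons] at ih
      have ht : ((t.children.flatMap evens).map fun e => e.word.length).sum =
          (blockTail t.label t.children).length := by
        rw [sum_map_flatMap, blockTail, List.length_flatMap]
        congr 1
        refine List.map_congr_left fun e he => ?_
        rw [ih.1 e he]
        simp
      have := iht ih.2 (by simp [word, children])
      rw [toWord_node_cons, List.flatMap_cons, List.map_append, List.sum_append, ht]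
      simp only [List.length_append, List.length_cons]
      omega

lemma length_evens_add_length_odds {M : Multiset ℕ} {T : OTree} (hT : T ∈ trees M) :
    T.evens.length + M.dedup.card = M.card + 1 := by
  have h := mem_trees_iff.1 hT
  have h₁ := congrArg Multiset.card (coe_label_vertices h.2.1)
  rw [h.2.2, Multiset.card_cons, Multiset.coe_card, List.length_map] at h₁
  have h₂ := congrArg Multiset.card (coe_odds_of_mem_trees hT)
  rw [Multiset.coe_card, List.length_map] at h₂
  have h₃ := sum_map_filter_add_sum_map_filter_not T.vertices (fun v => decide (Even v.1))
    fun _ => 1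
  rw [← h₂, ← h₁, ← filter_even_vertices, ← filter_odd_vertices, List.length_map, List.length_map]
  simpa using h₃

/-- The product of the weights of the words of the even vertices of a tree. -/
lemma prod_weight_evens {R : Type*} [CommRing R] (s t z : R) (es : List OTree)
    (hn : ∀ e ∈ es, e.word.Nodup)
    (hd : ∀ e ∈ es, ∀ i < e.word.length, ¬ IsDoubleCyclicDescent e.word i) :
    ∃ d, es.countP (fun e => e.children.isEmpty) + 2 * (es.map fun e => wordCdes e.word).sum + d =
        (es.map fun e => e.word.length).sum ∧
      (es.map fun e => if e.children.map label = [] then z else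
        cycProd (peakWeight s 0 t) e.label (e.children.map label)).prod =
      z ^ es.countP (fun e => e.children.isEmpty) * t ^ (es.map fun e => wordCdes e.word).sum *
        s ^ d := by
  induction es with
  | nil => exact ⟨0, by simp⟩
  | cons e es ih =>
    rw [List.forall_mem_cons] at hn hd
    obtain ⟨d, h₁, h₂⟩ := ih hn.2 hd.2
    simp only [List.map_cons, List.sum_cons, List.prod_cons, List.countP_cons, h₂]
    rcases e with ⟨v, ts⟩
    cases ts with
    | nil =>
      have hw : (node v []).word = List.replicate 1 v := rfl
      have hch : (node v []).children = [] := rfl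
      simp only [hw, wordCdes_replicate, hch, List.isEmpty_nil, List.map_nil, if_true,
        List.length_replicate]
      refine ⟨d, ?_, ?_⟩
      · omega
      · ring
    | cons c ts =>
      have h0 : (c :: ts).map label ≠ [] := by simp
      have h2 := two_le_length_cons (v := v) h0
      have hc := wordCdes_add_card_doubleAscents hn.1 h2 hd.1
      have hp := (cycProd_peakWeight_eq_ite s t h0 hn.1).trans (if_pos hd.1)
      have hch : (node v (c :: ts)).children = c :: ts := rfl
      refine ⟨d + ((node v (c :: ts)).word.length - 2 * wordCdes (node v (c :: ts)).word), ?_, ?_⟩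
      · simp only [hch, List.isEmpty_cons, Bool.false_eq_true, if_false]
        omega
      · simp only [hch, h0, if_false, hp, List.isEmpty_cons, Bool.false_eq_true]
        simp only [word, hch]
        ring

lemma prod_weight_evens_eq_zero {R : Type*} [CommRing R] (s t z : R) (es : List OTree)
    (hn : ∀ e ∈ es, e.word.Nodup)
    (hd : ¬ ∀ e ∈ es, ∀ i < e.word.length, ¬ IsDoubleCyclicDescent e.word i) :
    (es.map fun e => if e.children.map label = [] then z else
        cycProd (peakWeight s 0 t) e.label (e.children.map label)).prod = 0 := by
  rw [not_forall] at hd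
  obtain ⟨e, hd⟩ := hd
  rw [Classical.not_imp] at hd
  obtain ⟨he, hd⟩ := hd
  refine List.prod_eq_zero (List.mem_map.2 ⟨e, he, ?_⟩)
  have h0 : e.children.map label ≠ [] := by
    intro h
    refine hd fun i hi hdi => ?_
    rw [word, h] at hdi
    simp [IsDoubleCyclicDescent, cyclicEntry, Nat.mod_one] at hdi
  rw [if_neg h0, cycProd_peakWeight_eq_ite s t h0 (hn e he)]
  exact if_neg hd

lemma one_le_cdes_and_eleaf_lt {M : Multiset ℕ} (h0 : 0 ∉ M) (hM : M ≠ 0) {T : OTree} (hT : T ∈ trees M) :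
    1 ≤ T.cdes ∧ T.eleaf + 1 ≤ T.evens.length := by
  have h := mem_trees_iff.1 hT
  have hn := nodup_word h0 hT
  rw [cdes_eq_sum_evens h.2.1, eleaf_eq_countP_evens]
  obtain ⟨v, ts⟩ := T
  obtain rfl : v = 0 := h.1
  rw [evens_node] at hn ⊢
  have hts : ts ≠ [] := by
    rintro rfl
    rw [toWord_node_nil] at h
    exact hM h.2.2.symm
  rw [List.forall_mem_cons, List.nodup_cons] at hn
  constructor
  · rw [List.map_cons, List.sum_cons]
    refine le_add_right (one_le_wordCdes (v := 0) ?_ fun a ha => ?_)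
    · simpa [children] using hts
    · refine Nat.pos_of_ne_zero ?_
      rintro rfl
      exact hn.1.1 ha
  · rw [List.countP_cons, List.length_cons]
    have : (node 0 ts).children.isEmpty = false := by simpa [children] using hts
    rw [this]
    simp only [Bool.false_eq_true, if_false, add_zero]
    exact Nat.add_le_add_right List.countP_le_length 1

/-- The monomial in `z`, `xy` and `x + y` that a tree without double cyclic descents contributes. -/
noncomputable def gammaTerm (K i j : ℕ) : MvPolynomial (Fin 3) ℤ :=
  MvPolynomial.X 2 ^ i * (MvPolynomial.X 0 * MvPolynomial.X 1) ^ j *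
    (MvPolynomial.X 0 + MvPolynomial.X 1) ^ (K + 1 - i - 2 * j)

lemma weight_of_mem_trees {M : Multiset ℕ} (h0 : 0 ∉ M) {T : OTree} (hT : T ∈ trees M) :
    (T.evens.map fun e => if e.children.map label = [] then MvPolynomial.X 2 else
      cycProd (peakWeight (MvPolynomial.X 0 + MvPolynomial.X 1) 0
        (MvPolynomial.X 0 * MvPolynomial.X 1)) e.label (e.children.map label)).prod =
      if T.dcdes = 0 then gammaTerm M.card T.eleaf T.cdes else 0 := by
  have h := mem_trees_iff.1 hT
  split_ifs with hd
  · obtain ⟨d, h₁, h₂⟩ := prod_weight_evens (R := MvPolynomial (Fin 3) ℤ)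
      (MvPolynomial.X 0 + MvPolynomial.X 1) (MvPolynomial.X 0 * MvPolynomial.X 1)
      (MvPolynomial.X 2) T.evens (nodup_word h0 hT) ((dcdes_eq_zero_iff T).1 hd)
    rw [sum_length_word_evens, ← Multiset.coe_card, h.2.2, ← eleaf_eq_countP_evens,
      ← cdes_eq_sum_evens h.2.1] at h₁
    rw [h₂, ← eleaf_eq_countP_evens, ← cdes_eq_sum_evens h.2.1, gammaTerm,
      show M.card + 1 - T.eleaf - 2 * T.cdes = d by omega]
  · exact prod_weight_evens_eq_zero _ _ _ _ (nodup_word h0 hT)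
      (fun h => hd ((dcdes_eq_zero_iff T).2 h))

lemma two_mul_cdes_le {M : Multiset ℕ} (h0 : 0 ∉ M) {T : OTree} (hT : T ∈ trees M)
    (hd : T.dcdes = 0) : T.eleaf + 2 * T.cdes ≤ M.card + 1 := by
  have h := mem_trees_iff.1 hT
  obtain ⟨d, h₁, -⟩ := prod_weight_evens (R := ℤ) 0 0 0 T.evens (nodup_word h0 hT)
    ((dcdes_eq_zero_iff T).1 hd)
  rw [sum_length_word_evens, ← Multiset.coe_card, h.2.2, ← eleaf_eq_countP_evens,
    ← cdes_eq_sum_evens h.2.1] at h₁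
  omega

lemma quasiStirlingPoly_eq_sum_trees {M : Multiset ℕ} (h0 : 0 ∉ M) :
    quasiStirlingPoly M = ∑ T ∈ (trees_finite M).toFinset,
      if T.dcdes = 0 then gammaTerm M.card T.eleaf T.cdes else 0 := by
  have hb := bijOn_toWord M
  have h₁ : quasiStirlingPoly M = ∑ T ∈ (trees_finite M).toFinset, (T.evens.map fun e =>
      pairProd (stepWeight (MvPolynomial.X 0) (MvPolynomial.X 1) (MvPolynomial.X 2)) e.label
        (e.children.map label) e.label).prod := by
    symm
    refine Finset.sum_bij (fun T _ => toWord T) ?_ ?_ ?_ ?_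
    · exact fun T hT => hb.mapsTo ((trees_finite M).mem_toFinset.1 hT)
    · exact fun T hT T' hT' => hb.injOn ((trees_finite M).mem_toFinset.1 hT)
        ((trees_finite M).mem_toFinset.1 hT')
    · intro π hπ
      obtain ⟨T, hT, rfl⟩ := hb.surjOn hπ
      exact ⟨T, (trees_finite M).mem_toFinset.2 hT, rfl⟩
    · intro T hT
      have h := mem_trees_iff.1 ((trees_finite M).mem_toFinset.1 hT)
      rw [← pairProd_stepWeight_zero, ← pairProd_toWord _ T h.2.1, h.1]
  rw [h₁, sum_trees_eq h0 (fun v l => pairProd (stepWeight _ _ _) v l v) _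
    fun v s hs hv => sum_pairProd_stepWeight _ _ _ hs hv]
  exact Finset.sum_congr rfl fun T hT =>
    weight_of_mem_trees h0 ((trees_finite M).mem_toFinset.1 hT)

/-- The expansion of the quasi-Stirling polynomial for a multiset of positive integers. -/
theorem quasiStirlingPoly_eq {M : Multiset ℕ} (h0 : 0 ∉ M) (hM : M ≠ 0) :
    quasiStirlingPoly M = ∑ i ∈ Finset.range (M.card - M.dedup.card + 1), MvPolynomial.X 2 ^ i *
      ∑ j ∈ Finset.Icc 1 ((M.card + 1 - i) / 2), MvPolynomial.C (gammaCoeff M i j : ℤ) *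
        (MvPolynomial.X 0 * MvPolynomial.X 1) ^ j *
        (MvPolynomial.X 0 + MvPolynomial.X 1) ^ (M.card + 1 - i - 2 * j) := by
  classical
  rw [quasiStirlingPoly_eq_sum_trees h0, ← Finset.sum_filter]
  set S := (trees_finite M).toFinset.filter fun T => T.dcdes = 0 with hS
  have hmem : ∀ T, T ∈ S ↔ T ∈ trees M ∧ T.dcdes = 0 := by
    intro T
    rw [hS, Finset.mem_filter, Set.Finite.mem_toFinset]
  have hi : ∀ T ∈ S, T.eleaf ∈ Finset.range (M.card - M.dedup.card + 1) := by
    intro T hT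
    have h₁ := length_evens_add_length_odds ((hmem T).1 hT).1
    have h₂ := (one_le_cdes_and_eleaf_lt h0 hM ((hmem T).1 hT).1).2
    rw [Finset.mem_range]
    omega
  rw [← Finset.sum_fiberwise_of_maps_to hi]
  refine Finset.sum_congr rfl fun i _ => ?_
  have hj : ∀ T ∈ S.filter (fun T => T.eleaf = i),
      T.cdes ∈ Finset.Icc 1 ((M.card + 1 - i) / 2) := by
    intro T hT
    obtain ⟨hTS, rfl⟩ := Finset.mem_filter.1 hT
    obtain ⟨hT', hd⟩ := (hmem T).1 hTS
    have h₁ := (one_le_cdes_and_eleaf_lt h0 hM hT').1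
    have h₂ := two_mul_cdes_le h0 hT' hd
    rw [Finset.mem_Icc]
    omega
  rw [← Finset.sum_fiberwise_of_maps_to hj, Finset.mul_sum]
  refine Finset.sum_congr rfl fun j _ => ?_
  have hcard : gammaCoeff M i j =
      ((S.filter fun T => T.eleaf = i).filter fun T => T.cdes = j).card := by
    rw [gammaCoeff, ← Set.ncard_coe_finset]
    congr 1
    ext T
    simp only [Finset.coe_filter, Finset.mem_filter, hmem, Set.mem_ofPred_eq]
    tauto
  rw [Finset.sum_congr rfl (g := fun _ => gammaTerm M.card i j) fun T hT => by
    obtain ⟨hTi, hTj⟩ := Finset.mem_filter.1 hT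
    rw [(Finset.mem_filter.1 hTi).2, hTj]]
  rw [Finset.sum_const, ← hcard, gammaTerm, nsmul_eq_mul, map_natCast]
  ring

/-! ### Partial gamma-positivity -/

/-- An expansion with nonnegative coefficients gives partial γ-positivity. -/
lemma partialGammaPositive_of_eq {p : MvPolynomial (Fin 3) ℤ} (N m : ℕ) (γ : ℕ → ℕ → ℕ)
    (h : p = ∑ i ∈ Finset.range N, MvPolynomial.X 2 ^ i *
      ∑ j ∈ Finset.Icc 1 ((m - i) / 2), MvPolynomial.C (γ i j : ℤ) *
        (MvPolynomial.X 0 * MvPolynomial.X 1) ^ j *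
        (MvPolynomial.X 0 + MvPolynomial.X 1) ^ (m - i - 2 * j)) :
    PartialGammaPositive p := by
  refine ⟨N, fun i => ∑ j ∈ Finset.range ((m - i) / 2 + 1),
    MvPolynomial.C (if j = 0 then 0 else (γ i j : ℤ)) * (MvPolynomial.X 0 * MvPolynomial.X 1) ^ j *
      (MvPolynomial.X 0 + MvPolynomial.X 1) ^ (m - i - 2 * j), ?_, fun i =>
    ⟨m - i, fun j => if j = 0 then 0 else (γ i j : ℤ), fun j => ?_, rfl⟩⟩
  · rw [h]
    refine Finset.sum_congr rfl fun i _ => ?_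
    rw [mul_comm, map_sum]
    congr 1
    have hsub : Finset.Icc 1 ((m - i) / 2) ⊆ Finset.range ((m - i) / 2 + 1) := by
      intro j hj
      rw [Finset.mem_Icc] at hj
      rw [Finset.mem_range]
      omega
    rw [← Finset.sum_subset hsub]
    · refine Finset.sum_congr rfl fun j hj => ?_
      have hj0 : j ≠ 0 := by
        rw [Finset.mem_Icc] at hj
        omega
      simp only [hj0, if_false, map_mul, map_pow, map_add, MvPolynomial.rename_X,
        MvPolynomial.rename_C]
      rfl
    · intro j hj hj'
      have hj0 : j = 0 := by
        rw [Finset.mem_Icc] at hj'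
        rw [Finset.mem_range] at hj
        omega
      simp [hj0]
  · dsimp only
    split_ifs
    · rfl
    · exact Int.natCast_nonneg _

/-! ### The multiset `{1^{k_1}, …, n^{k_n}}` -/

lemma mem_multisetOf {n : ℕ} (k : Fin n → ℕ) (hk : ∀ i, 1 ≤ k i) (a : ℕ) :
    a ∈ multisetOf k ↔ ∃ i : Fin n, i.val + 1 = a := by
  simp only [multisetOf, Multiset.mem_sum, Multiset.mem_replicate, Finset.mem_univ, true_and]
  refine exists_congr fun i => ?_
  have := hk i
  exact ⟨fun h => h.2.symm, fun h => ⟨by omega, h.symm⟩⟩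

lemma card_multisetOf {n : ℕ} (k : Fin n → ℕ) : (multisetOf k).card = ∑ i, k i := by
  simp [multisetOf]

lemma card_dedup_multisetOf {n : ℕ} (k : Fin n → ℕ) (hk : ∀ i, 1 ≤ k i) :
    (multisetOf k).dedup.card = n := by
  have h : (multisetOf k).toFinset = Finset.univ.image fun i : Fin n => i.val + 1 := by
    ext a
    simp [mem_multisetOf k hk]
  have h' : (multisetOf k).dedup.card = (multisetOf k).toFinset.card := rfl
  rw [h', h, Finset.card_image_of_injective, Finset.card_univ, Fintype.card_fin]
  intro i j hij
  exact Fin.ext (by simpa using hij)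

end QuasiStirling

theorem theorem3 (n : ℕ) (hn : 1 ≤ n) (k : Fin n → ℕ) (hk : ∀ i, 1 ≤ k i)
    (M : Multiset ℕ) (hM : M = QuasiStirling.multisetOf k)
    (K : ℕ) (hK : K = ∑ i, k i) :
    (QuasiStirling.trees M).Finite ∧
    QuasiStirling.PartialGammaPositive (QuasiStirling.quasiStirlingPoly M) ∧
    QuasiStirling.quasiStirlingPoly M =
      ∑ i ∈ Finset.range (K - n + 1), MvPolynomial.X 2 ^ i *
        ∑ j ∈ Finset.Icc 1 ((K + 1 - i) / 2),
          MvPolynomial.C (QuasiStirling.gammaCoeff M i j : ℤ) *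
            (MvPolynomial.X 0 * MvPolynomial.X 1) ^ j *
            (MvPolynomial.X 0 + MvPolynomial.X 1) ^ (K + 1 - i - 2 * j) := by
  have hcard : M.card = K := by rw [hM, hK, QuasiStirling.card_multisetOf]
  have hdedup : M.dedup.card = n := by rw [hM, QuasiStirling.card_dedup_multisetOf k hk]
  have h0 : 0 ∉ M := by
    rw [hM, QuasiStirling.mem_multisetOf k hk]
    simp
  have hne : M ≠ 0 := by
    rintro h
    rw [h] at hdedup
    simp at hdedup
    omega
  have key := QuasiStirling.quasiStirlingPoly_eq h0 hne
  rw [hcard, hdedup] at key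
  exact ⟨QuasiStirling.trees_finite M, QuasiStirling.partialGammaPositive_of_eq _ _ _ key, key⟩
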